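/- Let $N\ge 2$ and let $\Omega\subset\mathbb R^N$ be a bounded domain whose boundary $\Gamma=\partial\Omega$ is $C^{1,1}$-smooth (finitely many rigidly moved coordinate neighbourhoods cover $\Gamma$, and in each of them $\Gamma$ is the graph of a $C^{1,1}$ function with $\Omega$ on one side of the graph and the complement of $\overline\Omega$ on the other). Let $d$ be the signed distance to $\Gamma$ (negative in $\Omega$), and for $\delta>0$ let $\Gamma(\delta)=\{x\in\mathbb R^N : |d(x)|<\delta\}$. Then there exists $\delta_0>0$ depending only on $N$ and $\Omega$, and for every $p\in[1,\infty]$ there exists a constant $C$ depending only on $p$, $N$ and $\Omega$, such that for all $\delta_1\in(0,\delta_0]$ and all $f\in W^{1,p}(\Gamma(\delta_1))$ the function $f$ has an (almost everywhere unique) trace on $\Gamma$, again denoted by $f$, which belongs to $L^p(\Gamma)$, and $$\|f\|_{L^p(\Gamma(\delta_1))}\le C\left(\delta_1\|\nabla f\|_{L^p(\Gamma(\delta_1))}+\delta_1^{1/p}\|f\|_{L^p(\Gamma)}\right),$$ where $\delta_1^{1/p}:=1$ if $p=\infty$ and $L^p(\Gamma)$ is taken with respect to the surface measure. In particular, for any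 constant $c>0$ the estimate holds, with this same $C$, for all $\delta_1\in[c\,h^2,2c\,h^2]$ as soon as $h>0$ satisfies $2c\,h^2\le\delta_0$. -/

import Mathlib

open MeasureTheory Filter Topology
open scoped ENNReal NNReal ContDiff

noncomputable section

/-- Euclidean space `ℝ^N`. -/
abbrev Eucl (N : ℕ) : Type := EuclideanSpace ℝ (Fin N)

/-- Local coordinates `(y', y_N) ∈ ℝ^(N-1) × ℝ`, with the Euclidean distance of `ℝ^N`. -/
abbrev LocalCoord (N : ℕ) : Type := WithLp 2 (Eucl (N - 1) × ℝ)

/-- `φ ∈ C^{1,1}(Δ)` for the open ball `Δ = {|y'| < α}`: `φ` is continuously differentiable on `Δ`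
and its derivative is Lipschitz on `Δ`. -/
def IsC11OnBall {m : ℕ} (φ : Eucl m → ℝ) (α : ℝ) : Prop :=
  ContDiffOn ℝ 1 φ (Metric.ball 0 α) ∧
    ∃ K : ℝ≥0, LipschitzOnWith K (fderiv ℝ φ) (Metric.ball 0 α)

/-- The coordinate neighbourhood of a chart: with `y = A x`, the points with `|y'| < α` and
`|y_N - φ(y')| < β`. -/
def chartNbhd {N : ℕ} (A : Eucl N ≃ᵃⁱ[ℝ] LocalCoord N) (φ : Eucl (N - 1) → ℝ) (α β : ℝ) :
    Set (Eucl N) :=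
  {x | ‖(A x).fst‖ < α ∧ |(A x).snd - φ (A x).fst| < β}

/-- The boundary of `Ω` is `C^{1,1}`-smooth: it is covered by finitely many coordinate
neighbourhoods `U r`, in each of which, in the rigidly moved coordinates `y = A r x`, the boundary
is the graph of a `C^{1,1}` function `φ r` over `{|y'| < α}`, the points above the graph (up to
height `β`) lie in `Ω`, and those below it lie outside the closure of `Ω`. -/
def HasC11Boundary {N : ℕ} (Ω : Set (Eucl N)) : Prop :=
  ∃ (M : ℕ) (A : Fin M → (Eucl N ≃ᵃⁱ[ℝ] LocalCoord N)) (φ : Fin M → Eucl (N - 1) → ℝ) (α β : ℝ),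
    0 < α ∧ 0 < β ∧
    frontier Ω ⊆ ⋃ r, chartNbhd (A r) (φ r) α β ∧
    ∀ r, IsC11OnBall (φ r) α ∧
      frontier Ω ∩ chartNbhd (A r) (φ r) α β =
        {x | ‖(A r x).fst‖ < α ∧ (A r x).snd = φ r (A r x).fst} ∧
      Ω ∩ chartNbhd (A r) (φ r) α β =
        {x | ‖(A r x).fst‖ < α ∧ φ r (A r x).fst < (A r x).snd ∧
          (A r x).snd < φ r (A r x).fst + β} ∧
      (closure Ω)ᶜ ∩ chartNbhd (A r) (φ r) α β =
        {x | ‖(A r x).fst‖ < α ∧ φ r (A r x).fst - β < (A r x).snd ∧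
          (A r x).snd < φ r (A r x).fst}

open Classical in
/-- The signed distance to the boundary of `Ω`, negative inside `Ω`. -/
def bdrySignedDist {N : ℕ} (Ω : Set (Eucl N)) (x : Eucl N) : ℝ :=
  if x ∈ Ω then -Metric.infDist x (frontier Ω) else Metric.infDist x (frontier Ω)

/-- The tubular neighbourhood `Γ(δ) = {x : |d(x)| < δ}` of the boundary `Γ` of `Ω`. -/
def tubularNbhd {N : ℕ} (Ω : Set (Eucl N)) (δ : ℝ) : Set (Eucl N) :=
  {x | |bdrySignedDist Ω x| < δ}

/-- The surface measure of the boundary of `Ω`: the `(N-1)`-dimensional Hausdorff measure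
(normalized so as to be the Lebesgue measure on `(N-1)`-dimensional planes), restricted to it. -/
def surfaceMeasure {N : ℕ} (Ω : Set (Eucl N)) : Measure (Eucl N) :=
  (Measure.euclideanHausdorffMeasure (N - 1) : Measure (Eucl N)).restrict (frontier Ω)

/-- `G` is the weak gradient of `f` on the open set `U`. -/
def HasWeakGradient {N : ℕ} (U : Set (Eucl N)) (f : Eucl N → ℝ) (G : Eucl N → Eucl N) : Prop :=
  LocallyIntegrableOn f U volume ∧ LocallyIntegrableOn G U volume ∧
    ∀ ψ : Eucl N → ℝ, ContDiff ℝ ∞ ψ → HasCompactSupport ψ → tsupport ψ ⊆ U →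
      ∀ i : Fin N, ∫ x in U, f x * fderiv ℝ ψ x (EuclideanSpace.single i 1) =
        - ∫ x in U, G x i * ψ x

/-- `f ∈ W^{1,p}(U)` with weak gradient `G`. -/
def MemSobolevWithGradient {N : ℕ} (p : ℝ≥0∞) (U : Set (Eucl N)) (f : Eucl N → ℝ)
    (G : Eucl N → Eucl N) : Prop :=
  HasWeakGradient U f G ∧ MemLp f p (volume.restrict U) ∧ MemLp G p (volume.restrict U)

/-- `g` is the trace on the boundary `Γ` of `Ω` of a function `f` defined near `Γ`: on some open
neighbourhood `V` of `Γ` there are smooth functions converging to `f` in `W^{1,1}(V)` whose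
restrictions to `Γ` converge to `g` in `L^1(Γ)`. -/
def IsTrace {N : ℕ} (Ω : Set (Eucl N)) (f g : Eucl N → ℝ) : Prop :=
  MemLp g 1 (surfaceMeasure Ω) ∧
  ∃ (V : Set (Eucl N)) (G : Eucl N → Eucl N) (ψ : ℕ → Eucl N → ℝ),
    IsOpen V ∧ frontier Ω ⊆ V ∧ MemSobolevWithGradient 1 V f G ∧
    (∀ k, ContDiff ℝ ∞ (ψ k)) ∧
    Tendsto (fun k => eLpNorm (fun x => ψ k x - f x) 1 (volume.restrict V)) atTop (𝓝 0) ∧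
    Tendsto (fun k => eLpNorm (fun x => gradient (ψ k) x - G x) 1 (volume.restrict V))
      atTop (𝓝 0) ∧
    Tendsto (fun k => eLpNorm (fun x => ψ k x - g x) 1 (surfaceMeasure Ω)) atTop (𝓝 0)

end

/-! Near the boundary Γ one integrates along vertical lines of graph charts. In a chart, `Φ (y, t)`
lies at height `t` above the boundary point over `y`; this shear followed by a rigid motion
preserves Lebesgue measure. For smooth `ψ` the fundamental theorem of calculus bounds `|ψ (Φ (y, t))
- ψ (Φ (y, 0))|` by a vertical integral of `|∇ψ|` over an interval `I` of length comparable to `δ₁`.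
That bound does not depend on `t`, so Hölder on the line gives `|I|^(1 - 1/p)`, integration in `t`
gives `|I|^(1/p)`, and together they make the factor `δ₁` before the gradient
(`eLpNorm_vertLIntegral_fst_le`). The boundary term carries `|I|^(1/p)` alone.

The gradient is available only in the tube itself, so the vertical segment from a point of the tube
to Γ must stay in the tube. This is the geometric core, in `isGraphChart_of_chartNbhd`: slide the
point and a nearby boundary point vertically together; they end on opposite sides of Γ, hence the
short segment between them meets Γ.

For Sobolev `f`, mollify. The gradients converge only on smaller tubes, so the increment inequality
is obtained almost everywhere there by an `L¹` limit (`ae_enorm_sub_le_vertLIntegral`), and the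
smaller tubes exhaust the full one. Being pointwise, the inequality then yields every `p`, infinity
included. Read the other way, it bounds the trace by the function and its gradient
(`exists_eLpNorm_trace_le`); this makes the boundary values of the mollifications Cauchy in `L¹(Γ)`
and gives existence, uniqueness and `p`-integrability of the trace. -/

open scoped Convolution

/-! ### Mollification and smooth approximation -/

open ContinuousLinearMap in
/-- Convolution with a normed bump function does not increase the `L¹` norm. -/
lemma ContDiffBump.eLpNorm_one_convolution_le {E F : Type*} [NormedAddCommGroup E]
    [InnerProductSpace ℝ E] [FiniteDimensional ℝ E] [MeasurableSpace E] [BorelSpace E]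
    [NormedAddCommGroup F] [NormedSpace ℝ F] [CompleteSpace F]
    (φ : ContDiffBump (0 : E)) {h : E → F}
    (hh : AEStronglyMeasurable h volume) :
    eLpNorm (φ.normed volume ⋆[lsmul ℝ ℝ, volume] h) 1 volume ≤ eLpNorm h 1 volume := by
  have hφm : AEStronglyMeasurable (φ.normed volume) (volume : Measure E) :=
    φ.continuous_normed.aestronglyMeasurable
  have hm := (hφm.convolution_integrand (lsmul ℝ ℝ) hh (μ := volume)).enorm
  simp only [eLpNorm_one_eq_lintegral_enorm]
  calc ∫⁻ x, ‖(φ.normed volume ⋆[lsmul ℝ ℝ, volume] h) x‖ₑ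
      ≤ ∫⁻ x, ∫⁻ t, ‖lsmul ℝ ℝ (φ.normed volume t) (h (x - t))‖ₑ :=
        lintegral_mono fun x => enorm_integral_le_lintegral_enorm _
    _ = ∫⁻ t, ∫⁻ x, ‖lsmul ℝ ℝ (φ.normed volume t) (h (x - t))‖ₑ := lintegral_lintegral_swap hm
    _ = ∫⁻ t, ‖φ.normed volume t‖ₑ * ∫⁻ x, ‖h x‖ₑ := by
        refine lintegral_congr fun t => ?_
        simp only [lsmul_apply, enorm_smul]
        rw [lintegral_const_mul' _ _ (by simp), lintegral_sub_right_eq_self (fun x => ‖h x‖ₑ)]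
    _ = (∫⁻ t, ‖φ.normed volume t‖ₑ) * ∫⁻ x, ‖h x‖ₑ :=
        lintegral_mul_const'' _ hφm.enorm
    _ = ∫⁻ x, ‖h x‖ₑ := by
        have : ∫⁻ t, ‖φ.normed volume t‖ₑ = 1 := by
          have h1 : ∀ t, ‖φ.normed volume t‖ₑ = ENNReal.ofReal (φ.normed volume t) := fun t =>
            Real.enorm_of_nonneg (φ.nonneg_normed t)
          simp only [h1]
          rw [← ofReal_integral_eq_lintegral_ofReal φ.integrable_normed
            (ae_of_all _ φ.nonneg_normed), φ.integral_normed, ENNReal.ofReal_one]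
        rw [this, one_mul]

open ContinuousLinearMap in
/-- Mollifications of an integrable function converge to it in `L¹`. -/
lemma ContDiffBump.tendsto_eLpNorm_one_convolution_sub {E F : Type*} [NormedAddCommGroup E]
    [InnerProductSpace ℝ E] [FiniteDimensional ℝ E] [MeasurableSpace E] [BorelSpace E]
    [NormedAddCommGroup F] [NormedSpace ℝ F] [CompleteSpace F]
    {φ : ℕ → ContDiffBump (0 : E)} (hφ : Tendsto (fun k => (φ k).rOut) atTop (𝓝 0)) {h : E → F}
    (hh : Integrable h volume) :
    Tendsto (fun k => eLpNorm (fun x => ((φ k).normed volume ⋆[lsmul ℝ ℝ, volume] h) x - h x) 1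
      volume) atTop (𝓝 0) := by
  rw [ENNReal.tendsto_nhds_zero]
  intro ε hε
  obtain rfl | hεt := eq_or_ne ε ⊤
  · simp
  lift ε to ℝ≥0 using hεt
  have hε : 0 < (ε : ℝ) := by exact_mod_cast hε
  obtain ⟨g, hgs, hgd, hg⟩ := (memLp_one_iff_integrable.2 hh).exist_eLpNorm_sub_le
    ENNReal.one_ne_top le_rfl (ε := ε / 3) (by positivity)
  have hgc : Continuous g := hgd.continuous
  have hgi : Integrable g volume := hgc.integrable_of_hasCompactSupport hgs
  -- For mollification radius below 1, both `g` and its mollification vanish off `S`, so uniform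
  -- closeness on `S` becomes `L¹` closeness. The `m + 1` below avoids dividing by zero when `S` is
  -- null.
  set S : Set E := Metric.cthickening 1 (tsupport g)
  have hS : volume S ≠ ⊤ := (hgs.isCompact.cthickening (r := 1)).measure_lt_top.ne
  set m : ℝ := (volume S).toReal
  have hm : 0 ≤ m := ENNReal.toReal_nonneg
  obtain ⟨δ, hδ, hδg⟩ := Metric.uniformContinuous_iff.1
    (hgs.uniformContinuous_of_continuous hgc) (ε / (3 * (m + 1))) (by positivity)
  have hev : ∀ᶠ k in atTop, (φ k).rOut < min δ 1 := hφ.eventually (gt_mem_nhds (by positivity))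
  filter_upwards [hev] with k hk
  set ψ := (φ k).normed (volume : Measure E)
  have hkδ := hk.trans_le (min_le_left _ _)
  have hk1 := hk.trans_le (min_le_right _ _)
  have e1 : eLpNorm (fun x => (ψ ⋆[lsmul ℝ ℝ, volume] g) x - g x) 1 volume
      ≤ ENNReal.ofReal (ε / 3) := by
    rw [eLpNorm_one_eq_lintegral_enorm]
    have hb : ∀ x, ‖(ψ ⋆[lsmul ℝ ℝ, volume] g) x - g x‖ₑ
        ≤ S.indicator (fun _ => ENNReal.ofReal (ε / (3 * (m + 1)))) x := by
      intro x
      by_cases hx : x ∈ S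
      · rw [Set.indicator_of_mem hx, ← ofReal_norm, ← dist_eq_norm]
        refine ENNReal.ofReal_le_ofReal ((φ k).dist_normed_convolution_le
          hgc.aestronglyMeasurable fun y hy => (hδg ?_).le)
        exact (Metric.mem_ball.1 hy).trans hkδ
      · have hz : ∀ y ∈ Metric.ball x 1, g y = 0 := by
          intro y hy
          by_contra hne
          exact hx (Metric.mem_cthickening_of_dist_le x y 1 _ (subset_tsupport g hne)
            (by rw [dist_comm]; exact (Metric.mem_ball.1 hy).le))
        have hc : (ψ ⋆[lsmul ℝ ℝ, volume] g) x = g x := by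
          refine (φ k).normed_convolution_eq_right fun y hy => ?_
          rw [hz y (Metric.ball_subset_ball hk1.le hy), hz x (Metric.mem_ball_self one_pos)]
        simp [hc]
    calc ∫⁻ x, ‖(ψ ⋆[lsmul ℝ ℝ, volume] g) x - g x‖ₑ
        ≤ ∫⁻ x, S.indicator (fun _ => ENNReal.ofReal (ε / (3 * (m + 1)))) x := lintegral_mono hb
      _ = ENNReal.ofReal (ε / (3 * (m + 1))) * volume S :=
          lintegral_indicator_const Metric.isClosed_cthickening.measurableSet _
      _ = ENNReal.ofReal (ε / (3 * (m + 1))) * ENNReal.ofReal m := by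
          rw [ENNReal.ofReal_toReal hS]
      _ ≤ ENNReal.ofReal (ε / 3) := by
          rw [← ENNReal.ofReal_mul (by positivity)]
          refine ENNReal.ofReal_le_ofReal ?_
          rw [div_mul_eq_mul_div, div_le_div_iff₀ (by positivity) (by positivity)]
          nlinarith
  have hψc : HasCompactSupport ψ := (φ k).hasCompactSupport_normed
  have hψd : Continuous ψ := (φ k).continuous_normed
  have cg : ConvolutionExists ψ g (lsmul ℝ ℝ) volume :=
    hψc.convolutionExists_left _ hψd hgi.locallyIntegrable
  have ch : ConvolutionExists ψ h (lsmul ℝ ℝ) volume :=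
    hψc.convolutionExists_left _ hψd hh.locallyIntegrable
  have chg : ConvolutionExists ψ (h - g) (lsmul ℝ ℝ) volume :=
    hψc.convolutionExists_left _ hψd (hh.sub hgi).locallyIntegrable
  have e2 := (φ k).eLpNorm_one_convolution_le (hh.sub hgi).aestronglyMeasurable
  have hdec : (fun x => (ψ ⋆[lsmul ℝ ℝ, volume] h) x - h x)
      = (ψ ⋆[lsmul ℝ ℝ, volume] (h - g)) + (fun x => (ψ ⋆[lsmul ℝ ℝ, volume] g) x - g x)
        - (h - g) := by
    have : ψ ⋆[lsmul ℝ ℝ, volume] h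
        = ψ ⋆[lsmul ℝ ℝ, volume] (h - g) + ψ ⋆[lsmul ℝ ℝ, volume] g := by
      rw [← chg.distrib_add cg, sub_add_cancel]
    funext x
    simp only [this, Pi.add_apply, Pi.sub_apply]
    abel
  have cont : ∀ u : E → F, LocallyIntegrable u volume →
      AEStronglyMeasurable (ψ ⋆[lsmul ℝ ℝ, volume] u) volume := fun u hu =>
    (hψc.continuous_convolution_left _ hψd hu).aestronglyMeasurable
  have m1 := cont _ (hh.sub hgi).locallyIntegrable
  have m2 := (cont _ hgi.locallyIntegrable).sub hgi.aestronglyMeasurable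
  rw [hdec]
  calc _ ≤ eLpNorm (ψ ⋆[lsmul ℝ ℝ, volume] (h - g)) 1 volume
        + eLpNorm (fun x => (ψ ⋆[lsmul ℝ ℝ, volume] g) x - g x) 1 volume
        + eLpNorm (h - g) 1 volume :=
        (eLpNorm_sub_le (m1.add m2) (hh.sub hgi).aestronglyMeasurable le_rfl).trans
          (add_le_add_left (eLpNorm_add_le m1 m2 le_rfl) _)
    _ ≤ ENNReal.ofReal (ε / 3) + ENNReal.ofReal (ε / 3) + ENNReal.ofReal (ε / 3) := by
        gcongr
        exact e2.trans hg
    _ = ε := by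
        rw [← ENNReal.ofReal_add (by positivity) (by positivity),
          ← ENNReal.ofReal_add (by positivity) (by positivity)]
        rw [show (ε : ℝ) / 3 + ε / 3 + ε / 3 = ε by ring, ENNReal.ofReal_coe_nnreal]

lemma gradient_apply {N : ℕ} (f : Eucl N → ℝ) (x : Eucl N) (i : Fin N) :
    gradient f x i = fderiv ℝ f x (EuclideanSpace.single i 1) := by
  rw [← inner_gradient_left, EuclideanSpace.inner_single_right]
  simp

open ContinuousLinearMap in
/-- Well inside `U` the gradient of a mollification is the mollification of the weak gradient. -/
lemma HasWeakGradient.gradient_convolution {N : ℕ} {U : Set (Eucl N)} (hU : IsOpen U)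
    {f : Eucl N → ℝ} {G : Eucl N → Eucl N} (hw : HasWeakGradient U f G)
    (hf : IntegrableOn f U) (hG : IntegrableOn G U) (φ : ContDiffBump (0 : Eucl N)) {x : Eucl N}
    (hx : Metric.closedBall x φ.rOut ⊆ U) :
    gradient (φ.normed volume ⋆[lsmul ℝ ℝ, volume] U.indicator f) x
      = (φ.normed volume ⋆[lsmul ℝ ℝ, volume] U.indicator G) x := by
  set ρ := φ.normed (volume : Measure (Eucl N))
  have hρc : HasCompactSupport ρ := φ.hasCompactSupport_normed
  have hρd : ContDiff ℝ ∞ ρ := φ.contDiff_normed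
  have hfi : LocallyIntegrable (U.indicator f) volume :=
    (hf.integrable_indicator hU.measurableSet).locallyIntegrable
  have hGi : LocallyIntegrable (U.indicator G) volume :=
    (hG.integrable_indicator hU.measurableSet).locallyIntegrable
  have hd := hρc.hasFDerivAt_convolution_left (lsmul ℝ ℝ) (hρd.of_le (by simp)) hfi x
  have hce : ConvolutionExists (fderiv ℝ ρ) (U.indicator f)
      ((lsmul ℝ ℝ).precompL (Eucl N)) volume :=
    (hρc.fderiv ℝ).convolutionExists_left _ (hρd.continuous_fderiv (by simp)) hfi
  have hce' : ConvolutionExists ρ (U.indicator G) (lsmul ℝ ℝ) volume :=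
    hρc.convolutionExists_left _ hρd.continuous hGi
  -- The reflected kernel is an admissible test function because its support lies in the closed ball
  -- contained in `U`; the sign from the reflection cancels the one in the weak derivative.
  set θ : Eucl N → ℝ := fun y => ρ (x - y)
  have hθd : ContDiff ℝ ∞ θ := hρd.comp (contDiff_const.sub contDiff_id)
  have hθc : HasCompactSupport θ := hρc.comp_homeomorph (Homeomorph.subLeft x)
  have hθs : tsupport θ ⊆ U := by
    refine (closure_minimal ?_ Metric.isClosed_closedBall).trans hx
    intro y hy
    have : x - y ∈ Function.support ρ := hy
    rw [φ.support_normed_eq] at this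
    rw [Metric.mem_closedBall, dist_comm, dist_eq_norm]
    simpa using (mem_ball_zero_iff.1 this).le
  have hθ' : ∀ y v, fderiv ℝ θ y v = - fderiv ℝ ρ (x - y) v := by
    intro y v
    have h1 : HasFDerivAt ρ (fderiv ℝ ρ (x - y)) (x - y) :=
      (hρd.differentiable (by simp)).differentiableAt.hasFDerivAt
    have h2 := h1.comp y ((hasFDerivAt_id y).const_sub x)
    have h3 : fderiv ℝ θ y = _ := h2.fderiv
    rw [h3]
    simp
  ext i
  rw [gradient_apply, hd.fderiv]
  have hL : ((fderiv ℝ ρ ⋆[(lsmul ℝ ℝ).precompL (Eucl N), volume] U.indicator f) x)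
      (EuclideanSpace.single i 1)
      = ∫ y, fderiv ℝ ρ (x - y) (EuclideanSpace.single i 1) * U.indicator f y := by
    rw [convolution_eq_swap, integral_apply]
    · rfl
    · exact (hce x).integrable_swap
  have hR : (ρ ⋆[lsmul ℝ ℝ, volume] U.indicator G) x i = ∫ y, θ y * U.indicator G y i := by
    rw [convolution_eq_swap]
    have := (EuclideanSpace.proj (𝕜 := ℝ) i).integral_comp_comm (hce' x).integrable_swap
    exact this.symm
  rw [hL, hR]
  have key := hw.2.2 θ hθd hθc hθs i
  simp only [hθ', mul_neg, integral_neg, neg_inj] at key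
  rw [← integral_indicator hU.measurableSet, ← integral_indicator hU.measurableSet] at key
  refine (integral_congr_ae (ae_of_all _ fun y => ?_)).trans
    (key.trans (integral_congr_ae (ae_of_all _ fun y => ?_))) <;>
    by_cases hy : y ∈ U <;> simp [hy, mul_comm]

open ContinuousLinearMap in
/-- Functions in `W^{1,1}(U)` are limits of smooth functions, in `L¹(U)`, with convergence of the
gradients in `L¹` well inside `U`. -/
lemma HasWeakGradient.exists_smooth_approx {N : ℕ} {U : Set (Eucl N)} (hU : IsOpen U)
    {f : Eucl N → ℝ} {G : Eucl N → Eucl N} (hw : HasWeakGradient U f G)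
    (hf : IntegrableOn f U) (hG : IntegrableOn G U) :
    ∃ ψ : ℕ → Eucl N → ℝ, (∀ k, ContDiff ℝ ∞ (ψ k)) ∧
      Tendsto (fun k => eLpNorm (fun x => ψ k x - f x) 1 (volume.restrict U)) atTop (𝓝 0) ∧
      ∀ (V : Set (Eucl N)) (η : ℝ), 0 < η → MeasurableSet V → Metric.thickening η V ⊆ U →
        Tendsto (fun k => eLpNorm (fun x => gradient (ψ k) x - G x) 1 (volume.restrict V))
          atTop (𝓝 0) := by
  have hpos : ∀ k : ℕ, (0 : ℝ) < 1 / (k + 1 : ℝ) := fun k => Nat.one_div_pos_of_nat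
  let φ : ℕ → ContDiffBump (0 : Eucl N) := fun k =>
    ⟨1 / (k + 1 : ℝ) / 2, 1 / (k + 1 : ℝ), half_pos (hpos k), half_lt_self (hpos k)⟩
  have hφ : Tendsto (fun k => (φ k).rOut) atTop (𝓝 0) := tendsto_one_div_add_atTop_nhds_zero_nat
  have hfi := hf.integrable_indicator hU.measurableSet
  have hGi := hG.integrable_indicator hU.measurableSet
  refine ⟨fun k => (φ k).normed volume ⋆[lsmul ℝ ℝ, volume] U.indicator f, fun k => ?_, ?_, ?_⟩
  · exact (φ k).hasCompactSupport_normed.contDiff_convolution_left _ (φ k).contDiff_normed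
      hfi.locallyIntegrable
  · refine tendsto_of_tendsto_of_tendsto_of_le_of_le tendsto_const_nhds
      (ContDiffBump.tendsto_eLpNorm_one_convolution_sub hφ hfi) (fun _ => zero_le) fun k => ?_
    refine le_trans (eLpNorm_mono_enorm_ae ?_) (eLpNorm_mono_measure _ Measure.restrict_le_self)
    refine (ae_restrict_iff' hU.measurableSet).2 (ae_of_all _ fun x hx => ?_)
    simp [hx]
  · intro V η hη hV hVU
    refine tendsto_of_tendsto_of_tendsto_of_le_of_le' tendsto_const_nhds
      (ContDiffBump.tendsto_eLpNorm_one_convolution_sub hφ hGi)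
      (Eventually.of_forall fun _ => zero_le) ?_
    filter_upwards [hφ.eventually (gt_mem_nhds hη)] with k hk
    refine le_trans (eLpNorm_mono_enorm_ae ?_) (eLpNorm_mono_measure _ Measure.restrict_le_self)
    refine (ae_restrict_iff' hV).2 (ae_of_all _ fun x hx => ?_)
    have hb : Metric.closedBall x (φ k).rOut ⊆ U := fun y hy => hVU
      (Metric.mem_thickening_iff.2 ⟨x, hx, (Metric.mem_closedBall.1 hy).trans_lt hk⟩)
    have hxU : x ∈ U := hb (Metric.mem_closedBall_self (φ k).rOut_pos.le)
    rw [hw.gradient_convolution hU hf hG (φ k) hb]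
    simp [hxU]

/-! ### Restriction and uniqueness of weak gradients -/

/-- Weak gradients restrict to smaller sets. -/
lemma HasWeakGradient.mono {N : ℕ} {U W : Set (Eucl N)} (hWU : W ⊆ U) {f : Eucl N → ℝ}
    {G : Eucl N → Eucl N} (h : HasWeakGradient U f G) : HasWeakGradient W f G := by
  refine ⟨h.1.mono_set hWU, h.2.1.mono_set hWU, fun θ hθ hθc hθW i => ?_⟩
  -- The integrands vanish off the support of `θ`, so the integrals over `W` and over `U` both equal
  -- the integral over the whole space.
  have hset : ∀ {T : Set (Eucl N)} (u : Eucl N → ℝ), W ⊆ T → (∀ x, x ∉ tsupport θ → u x = 0) →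
      ∫ x in T, u x = ∫ x, u x := fun u hT hu =>
    setIntegral_eq_integral_of_forall_compl_eq_zero fun x hx => hu x fun hx' => hx (hT (hθW hx'))
  have z1 : ∀ x, x ∉ tsupport θ → G x i * θ x = 0 := fun x hx => by
    rw [image_eq_zero_of_notMem_tsupport hx, mul_zero]
  have z2 : ∀ x, x ∉ tsupport θ → f x * fderiv ℝ θ x (EuclideanSpace.single i 1) = 0 := by
    intro x hx
    rw [fderiv_of_notMem_tsupport ℝ hx]
    simp
  have e := h.2.2 θ hθ hθc (hθW.trans hWU) i
  rwa [hset _ hWU z2, hset _ hWU z1, ← hset _ subset_rfl z2, ← hset _ subset_rfl z1] at e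

/-- The weak gradient is unique up to null sets. -/
lemma HasWeakGradient.ae_unique {N : ℕ} {W : Set (Eucl N)} (hW : IsOpen W) {f : Eucl N → ℝ}
    {G G' : Eucl N → Eucl N} (h : HasWeakGradient W f G) (h' : HasWeakGradient W f G') :
    G =ᵐ[volume.restrict W] G' := by
  have hi : ∀ i : Fin N, ∀ᵐ x, x ∈ W → G x i - G' x i = 0 := by
    intro i
    have hc : ∀ {H : Eucl N → Eucl N}, LocallyIntegrableOn H W volume →
        LocallyIntegrableOn (fun x => H x i) W volume := by
      intro H hH x hx
      obtain ⟨s, hs, hsi⟩ := hH x hx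
      exact ⟨s, hs, (EuclideanSpace.proj (𝕜 := ℝ) i).integrable_comp hsi⟩
    have hl := hc h.2.1
    have hl' := hc h'.2.1
    refine hW.ae_eq_zero_of_integral_contDiff_smul_eq_zero (hl.sub hl') ?_
    intro θ hθ hθc hθW
    have e := (h.2.2 θ hθ hθc hθW i).symm.trans (h'.2.2 θ hθ hθc hθW i)
    have z : ∀ u : Eucl N → ℝ, ∀ x, x ∉ tsupport θ → u x * θ x = 0 := fun u x hx => by
      rw [image_eq_zero_of_notMem_tsupport hx, mul_zero]
    have hint : ∀ {u : Eucl N → ℝ}, LocallyIntegrableOn u W volume →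
        IntegrableOn (fun x => u x * θ x) W := by
      intro u hu
      have h1 : IntegrableOn u (tsupport θ) :=
        (hu.mono_set hθW).integrableOn_isCompact hθc.isCompact
      have h2 := h1.mul_continuousOn hθ.continuous.continuousOn hθc.isCompact
      exact ((integrableOn_iff_integrable_of_support_subset fun x hx => by
        by_contra hne
        exact hx (z u x hne)).1 h2).integrableOn
    calc ∫ x, θ x • (G x i - G' x i)
        = ∫ x in W, (G x i * θ x - G' x i * θ x) := by
          rw [← setIntegral_eq_integral_of_forall_compl_eq_zero (s := W)]
          · refine integral_congr_ae (ae_of_all _ fun x => ?_)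
            simp only [smul_eq_mul]
            ring
          · intro x hx
            rw [image_eq_zero_of_notMem_tsupport fun hx' => hx (hθW hx'), zero_smul]
      _ = 0 := by
          rw [integral_sub (hint hl) (hint hl')]
          linarith
  refine (ae_restrict_iff' hW.measurableSet).2 ?_
  filter_upwards [ae_all_iff.2 hi] with x hx hxW
  ext i
  exact sub_eq_zero.1 (hx i hxW)

/-! ### Lebesgue norms on products -/

/-- The first projection pushes the product measure to a multiple of `μ`. The exponent
`(p⁻¹).toReal` is 0 at infinity, which treats all `p` at once; there `ν ≠ 0` matters, since `0 ^ 0 =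
1` while the norm for the zero measure is 0. -/
lemma eLpNorm_comp_fst_prod {α β F : Type*} [MeasurableSpace α] [MeasurableSpace β]
    [TopologicalSpace F] [ContinuousENorm F] {μ : Measure α} {ν : Measure β} [SFinite μ]
    [SFinite ν] (hν : ν Set.univ ≠ 0) {a : α → F}
    (ha : AEStronglyMeasurable a μ) (p : ℝ≥0∞) :
    eLpNorm (fun z : α × β => a z.1) p (μ.prod ν)
      = ν Set.univ ^ (p⁻¹).toReal * eLpNorm a p μ := by
  have hmap : (μ.prod ν).map Prod.fst = ν Set.univ • μ := Measure.map_fst_prod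
  have h := eLpNorm_map_measure (p := p) (μ := μ.prod ν) (f := Prod.fst) (g := a)
    (by rw [hmap]; exact ha.mono_ac Measure.smul_absolutelyContinuous) measurable_fst.aemeasurable
  rw [hmap, eLpNorm_smul_measure_of_ne_zero hν] at h
  rw [← one_div, ← smul_eq_mul, h]
  rfl

/-- Hölder's inequality in one of the two variables. -/
lemma eLpNorm_lintegral_prod_le {α β : Type*} [MeasurableSpace α] [MeasurableSpace β]
    {μ : Measure α} {ν : Measure β} [SFinite μ] [SFinite ν] {p : ℝ≥0∞} (hp : 1 ≤ p)
    {h : α × β → ℝ≥0∞} (hh : Measurable h) :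
    eLpNorm (fun y => ∫⁻ s, h (y, s) ∂ν) p μ
      ≤ ν Set.univ ^ (1 - (p⁻¹).toReal) * eLpNorm h p (μ.prod ν) := by
  have hin : ∀ y, ∫⁻ s, h (y, s) ∂ν
      ≤ ν Set.univ ^ (1 - (p⁻¹).toReal) * eLpNorm (fun s => h (y, s)) p ν := by
    intro y
    have := eLpNorm_le_eLpNorm_mul_rpow_measure_univ hp (μ := ν) (f := fun s => h (y, s))
      (hh.comp measurable_prodMk_left).aestronglyMeasurable
    rw [eLpNorm_one_eq_lintegral_enorm, mul_comm] at this
    simpa [ENNReal.toReal_inv] using this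
  obtain rfl | hpt := eq_or_ne p ⊤
  · simp only [eLpNorm_exponent_top] at hin ⊢
    refine eLpNormEssSup_le_of_ae_enorm_bound ?_
    filter_upwards [Measure.ae_ae_of_ae_prod (ae_le_eLpNormEssSup (f := h) (μ := μ.prod ν))]
      with y hy
    refine (hin y).trans (mul_le_mul_right (eLpNormEssSup_le_of_ae_enorm_bound hy) _)
  · have hp0 : p ≠ 0 := (one_pos.trans_le hp).ne'
    have hpr : 0 < p.toReal := ENNReal.toReal_pos hp0 hpt
    set c := ν Set.univ ^ (1 - (p⁻¹).toReal)
    have hm : Measurable fun y => eLpNorm (fun s => h (y, s)) p ν := by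
      simp only [eLpNorm_eq_lintegral_rpow_enorm_toReal hp0 hpt, enorm_eq_self]
      exact (hh.pow_const _).lintegral_prod_right'.pow_const _
    calc eLpNorm (fun y => ∫⁻ s, h (y, s) ∂ν) p μ
        ≤ eLpNorm (fun y => c * eLpNorm (fun s => h (y, s)) p ν) p μ :=
          eLpNorm_mono_enorm fun y => hin y
      _ = c * eLpNorm h p (μ.prod ν) := by
          simp only [eLpNorm_eq_lintegral_rpow_enorm_toReal hp0 hpt, enorm_eq_self]
          rw [lintegral_prod _ (hh.pow_const _).aemeasurable]
          have e : ∀ y, (c * (∫⁻ s, h (y, s) ^ p.toReal ∂ν) ^ (1 / p.toReal)) ^ p.toReal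
              = c ^ p.toReal * ∫⁻ s, h (y, s) ^ p.toReal ∂ν := fun y => by
            rw [ENNReal.mul_rpow_of_nonneg _ _ hpr.le, one_div, ENNReal.rpow_inv_rpow hpr.ne']
          simp only [e]
          rw [lintegral_const_mul _ (hh.pow_const _).lintegral_prod_right',
            ENNReal.mul_rpow_of_nonneg _ _ (by positivity), one_div, ENNReal.rpow_rpow_inv hpr.ne']

/-! ### Increments along vertical lines -/

lemma ContDiff.continuous_gradient {N : ℕ} {ψ : Eucl N → ℝ} (hψ : ContDiff ℝ ∞ ψ) :
    Continuous (gradient ψ) :=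
  (InnerProductSpace.toDual ℝ (Eucl N)).symm.continuous.comp (hψ.continuous_fderiv (by simp))

/-- The increment of a function along a segment is controlled by its gradient. -/
lemma enorm_sub_le_lintegral_gradient {N : ℕ} {ψ : Eucl N → ℝ} (hψ : ContDiff ℝ ∞ ψ)
    (x v : Eucl N) (hv : ‖v‖ = 1) (t : ℝ) :
    ‖ψ (x + t • v) - ψ x‖ₑ ≤ ∫⁻ s in Set.uIoc 0 t, ‖gradient ψ (x + s • v)‖ₑ := by
  have hd : ∀ s : ℝ, HasDerivAt (fun s : ℝ => ψ (x + s • v)) (fderiv ℝ ψ (x + s • v) v) s := by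
    intro s
    have h1 : HasFDerivAt ψ (fderiv ℝ ψ (x + s • v)) (x + s • v) :=
      (hψ.differentiable (by simp)).differentiableAt.hasFDerivAt
    have h2 : HasDerivAt (fun s : ℝ => x + s • v) v s := by
      simpa using ((hasDerivAt_id s).smul_const v).const_add x
    exact h1.comp_hasDerivAt s h2
  have hc : Continuous fun s : ℝ => fderiv ℝ ψ (x + s • v) v :=
    ((hψ.continuous_fderiv (by simp)).comp (by fun_prop)).clm_apply continuous_const
  have h := intervalIntegral.integral_eq_sub_of_hasDerivAt (fun s _ => hd s)
    (hc.intervalIntegrable 0 t)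
  rw [zero_smul, add_zero] at h
  rw [← h, ← ofReal_norm, intervalIntegral.norm_intervalIntegral_eq, ofReal_norm]
  refine (enorm_integral_le_lintegral_enorm _).trans (lintegral_mono fun s => ?_)
  rw [← inner_gradient_left, enorm_le_iff_norm_le]
  simpa [hv] using norm_inner_le_norm (𝕜 := ℝ) (gradient ψ (x + s • v)) v

section Vertical

variable {m N : ℕ} {Φ : Eucl m × ℝ → Eucl N} {v : Eucl N}

/-- Integrals along vertical lines of the part of `G` inside `V`. -/
noncomputable def vertLIntegral (Φ : Eucl m × ℝ → Eucl N) (I : Set ℝ) (V : Set (Eucl N))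
    (G : Eucl N → Eucl N) (y : Eucl m) : ℝ≥0∞ :=
  ∫⁻ s in I, V.indicator (fun x => ‖G x‖ₑ) (Φ (y, s))

lemma measurable_indicator_enorm_comp (hΦ : Measurable Φ) {V : Set (Eucl N)}
    (hV : MeasurableSet V) {G : Eucl N → Eucl N} (hG : StronglyMeasurable G) :
    Measurable fun z => V.indicator (fun x => ‖G x‖ₑ) (Φ z) :=
  (hG.enorm.indicator hV).comp hΦ

lemma measurable_vertLIntegral (hΦ : Measurable Φ) (I : Set ℝ) {V : Set (Eucl N)}
    (hV : MeasurableSet V) {G : Eucl N → Eucl N} (hG : StronglyMeasurable G) :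
    Measurable (vertLIntegral Φ I V G) :=
  (measurable_indicator_enorm_comp hΦ hV hG).lintegral_prod_right'

/-- The segment lies in `V` and over `I`, so its integral can be enlarged to one over all of `I`,
cut off to `V`. The gain is a bound depending on `y` only. -/
lemma enorm_sub_le_vertLIntegral (hlin : ∀ y t, Φ (y, t) = Φ (y, 0) + t • v) (hv : ‖v‖ = 1)
    {ψ : Eucl N → ℝ} (hψ : ContDiff ℝ ∞ ψ) {I : Set ℝ} {V : Set (Eucl N)} {y : Eucl m} {t : ℝ}
    (h : ∀ s ∈ Set.uIcc 0 t, s ∈ I ∧ Φ (y, s) ∈ V) :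
    ‖ψ (Φ (y, t)) - ψ (Φ (y, 0))‖ₑ ≤ vertLIntegral Φ I V (gradient ψ) y := by
  rw [hlin y t]
  refine (enorm_sub_le_lintegral_gradient hψ _ v hv t).trans ?_
  calc ∫⁻ s in Set.uIoc 0 t, ‖gradient ψ (Φ (y, 0) + s • v)‖ₑ
      = ∫⁻ s in Set.uIoc 0 t, V.indicator (fun x => ‖gradient ψ x‖ₑ) (Φ (y, s)) := by
        refine setLIntegral_congr_fun measurableSet_uIoc fun s hs => ?_
        rw [Set.indicator_of_mem (h s (Set.uIoc_subset_uIcc hs)).2, ← hlin y s]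
    _ ≤ _ := lintegral_mono_set fun s hs => (h s (Set.uIoc_subset_uIcc hs)).1

lemma lintegral_vertLIntegral_le
    (hΦ : MeasurePreserving Φ (volume.prod volume) volume) (I : Set ℝ) {V : Set (Eucl N)}
    (hV : MeasurableSet V) {G : Eucl N → Eucl N} (hG : StronglyMeasurable G) :
    ∫⁻ y, vertLIntegral Φ I V G y ≤ ∫⁻ x in V, ‖G x‖ₑ := by
  have hm := measurable_indicator_enorm_comp hΦ.measurable hV hG
  calc ∫⁻ y, vertLIntegral Φ I V G y
      ≤ ∫⁻ y, ∫⁻ s, V.indicator (fun x => ‖G x‖ₑ) (Φ (y, s)) :=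
        lintegral_mono fun y => setLIntegral_le_lintegral _ _
    _ = ∫⁻ z, V.indicator (fun x => ‖G x‖ₑ) (Φ z) ∂(volume.prod volume) :=
        (lintegral_prod _ hm.aemeasurable).symm
    _ = ∫⁻ x, V.indicator (fun x => ‖G x‖ₑ) x := hΦ.lintegral_comp (hG.enorm.indicator hV)
    _ = _ := lintegral_indicator hV _

/-- The exponents `1/p`, from a function constant in the vertical variable, and `1 - 1/p`, from
Hölder, add up to 1. This is the source of the factor `δ₁` before the gradient. -/
lemma eLpNorm_vertLIntegral_fst_le
    (hΦ : MeasurePreserving Φ (volume.prod volume) volume) {I : Set ℝ} (hI0 : volume I ≠ 0)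
    (hIt : volume I ≠ ⊤) (B : Set (Eucl m)) {V : Set (Eucl N)}
    (hV : MeasurableSet V) {G : Eucl N → Eucl N} (hG : StronglyMeasurable G) {p : ℝ≥0∞}
    (hp : 1 ≤ p) :
    eLpNorm (fun z : Eucl m × ℝ => vertLIntegral Φ I V G z.1) p
      ((volume.restrict B).prod (volume.restrict I))
      ≤ volume I * eLpNorm G p (volume.restrict V) := by
  have hu : (volume.restrict I) Set.univ = volume I := Measure.restrict_apply_univ I
  have hm := measurable_indicator_enorm_comp hΦ.measurable hV hG
  rw [eLpNorm_comp_fst_prod (by rwa [hu])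
    (measurable_vertLIntegral hΦ.measurable I hV hG).aestronglyMeasurable, hu]
  have h2 : eLpNorm (vertLIntegral Φ I V G) p (volume.restrict B)
      ≤ volume I ^ (1 - (p⁻¹).toReal) * eLpNorm G p (volume.restrict V) := by
    refine (eLpNorm_lintegral_prod_le hp hm).trans ?_
    rw [hu]
    refine mul_le_mul_right ?_ _
    rw [Measure.prod_restrict]
    refine (eLpNorm_mono_measure _ Measure.restrict_le_self).trans ?_
    have h3 := eLpNorm_comp_measurePreserving (p := p)
      (hG.enorm.indicator hV).aestronglyMeasurable hΦ
    refine (le_of_eq h3).trans ?_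
    rw [eLpNorm_indicator_eq_eLpNorm_restrict hV, eLpNorm_enorm]
  calc _ ≤ volume I ^ (p⁻¹).toReal * (volume I ^ (1 - (p⁻¹).toReal)
        * eLpNorm G p (volume.restrict V)) := mul_le_mul_right h2 _
    _ = _ := by
        rw [← mul_assoc, ← ENNReal.rpow_add _ _ hI0 hIt]
        simp

/-- Passage to the limit in the vertical increment estimate. -/
lemma ae_enorm_sub_le_vertLIntegral
    (hΦ : MeasurePreserving Φ (volume.prod volume) volume)
    (hlin : ∀ y t, Φ (y, t) = Φ (y, 0) + t • v) (hv : ‖v‖ = 1) {I : Set ℝ}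
    (hIt : volume I ≠ ⊤) {V : Set (Eucl N)} (hV : MeasurableSet V) {B : Set (Eucl m)}
    {σ : Measure (Eucl N)} (hB : (volume.restrict B).map (fun y => Φ (y, 0)) ≤ σ)
    {S : Set (Eucl m × ℝ)} (hS : MeasurableSet S)
    (hSV : ∀ y t, (y, t) ∈ S → y ∈ B ∧ ∀ s ∈ Set.uIcc 0 t, s ∈ I ∧ Φ (y, s) ∈ V)
    {f g : Eucl N → ℝ} {G : Eucl N → Eucl N} (hf : StronglyMeasurable f)
    (hg : StronglyMeasurable g) (hG : StronglyMeasurable G) {ψ : ℕ → Eucl N → ℝ}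
    (hψ : ∀ k, ContDiff ℝ ∞ (ψ k))
    (hψf : Tendsto (fun k => eLpNorm (fun x => ψ k x - f x) 1 (volume.restrict V)) atTop (𝓝 0))
    (hψG : Tendsto (fun k => eLpNorm (fun x => gradient (ψ k) x - G x) 1 (volume.restrict V))
      atTop (𝓝 0))
    (hψg : Tendsto (fun k => eLpNorm (fun x => ψ k x - g x) 1 σ) atTop (𝓝 0)) :
    ∀ᵐ z ∂((volume.prod volume).restrict S),
      ‖f (Φ z) - g (Φ (z.1, 0))‖ₑ ≤ vertLIntegral Φ I V G z.1 := by
  have hγ : Measurable fun y : Eucl m => Φ (y, 0) :=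
    hΦ.measurable.comp (measurable_id.prodMk measurable_const)
  have hSI : S ⊆ B ×ˢ I := fun z hz =>
    ⟨(hSV z.1 z.2 hz).1, ((hSV z.1 z.2 hz).2 z.2 Set.right_mem_uIcc).1⟩
  have hSΦ : S ⊆ Φ ⁻¹' V := fun z hz => ((hSV z.1 z.2 hz).2 z.2 Set.right_mem_uIcc).2
  have hfst : ∀ {q : Eucl m → ℝ≥0∞}, Measurable q →
      ∫⁻ z in S, q z.1 ∂(volume.prod volume) ≤ volume I * ∫⁻ y in B, q y := by
    intro q hq
    refine (lintegral_mono_set hSI).trans ?_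
    have hq' : Measurable fun z : Eucl m × ℝ => q z.1 := hq.comp measurable_fst
    rw [← Measure.prod_restrict, lintegral_prod _ hq'.aemeasurable]
    simp only [lintegral_const, Measure.restrict_apply_univ]
    rw [lintegral_mul_const _ hq, mul_comm]
  have hGk : ∀ k, StronglyMeasurable (gradient (ψ k)) := fun k =>
    (hψ k).continuous_gradient.stronglyMeasurable
  -- Truncated subtraction in `ℝ≥0∞` measures the excess over the desired bound. Its integral is at
  -- most three approximation errors, which tend to zero, so the excess vanishes almost everywhere
  -- with no passage to subsequences.
  have hb : ∀ k, ∫⁻ z in S, (‖f (Φ z) - g (Φ (z.1, 0))‖ₑ - vertLIntegral Φ I V G z.1)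
        ∂(volume.prod volume)
      ≤ eLpNorm (fun x => ψ k x - f x) 1 (volume.restrict V)
        + volume I * eLpNorm (fun x => ψ k x - g x) 1 σ
        + volume I * eLpNorm (fun x => gradient (ψ k) x - G x) 1 (volume.restrict V) := by
    intro k
    have hcf : Measurable fun x => ‖ψ k x - f x‖ₑ :=
      ((hψ k).continuous.stronglyMeasurable.sub hf).enorm
    have hcg : Measurable fun x => ‖ψ k x - g x‖ₑ :=
      ((hψ k).continuous.stronglyMeasurable.sub hg).enorm
    have hD := (hGk k).sub hG
    have hvm := measurable_vertLIntegral hΦ.measurable I hV hD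
    have hvm' : Measurable fun z : Eucl m × ℝ => vertLIntegral Φ I V (gradient (ψ k) - G) z.1 :=
      hvm.comp measurable_fst
    have hpt : ∀ z ∈ S, ‖f (Φ z) - g (Φ (z.1, 0))‖ₑ - vertLIntegral Φ I V G z.1
        ≤ ‖ψ k (Φ z) - f (Φ z)‖ₑ + ‖ψ k (Φ (z.1, 0)) - g (Φ (z.1, 0))‖ₑ
          + vertLIntegral Φ I V (gradient (ψ k) - G) z.1 := by
      rintro ⟨y, t⟩ hz
      rw [tsub_le_iff_right]
      have h1 := enorm_sub_le_vertLIntegral hlin hv (hψ k) (hSV y t hz).2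
      have h2 : vertLIntegral Φ I V (gradient (ψ k)) y
          ≤ vertLIntegral Φ I V (gradient (ψ k) - G) y + vertLIntegral Φ I V G y := by
        refine le_trans (lintegral_mono fun s => ?_) (lintegral_add_left
          ((measurable_indicator_enorm_comp hΦ.measurable hV hD).comp
            measurable_prodMk_left) _).le
        by_cases hs : Φ (y, s) ∈ V
        · simp only [Function.comp_apply, Set.indicator_of_mem hs]
          calc ‖gradient (ψ k) (Φ (y, s))‖ₑ
              = ‖(gradient (ψ k) - G) (Φ (y, s)) + G (Φ (y, s))‖ₑ := by simp
            _ ≤ _ := enorm_add_le _ _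
        · simp [hs]
      have h3 : f (Φ (y, t)) - g (Φ (y, 0)) = -(ψ k (Φ (y, t)) - f (Φ (y, t)))
          + (ψ k (Φ (y, 0)) - g (Φ (y, 0))) + (ψ k (Φ (y, t)) - ψ k (Φ (y, 0))) := by ring
      calc ‖f (Φ (y, t)) - g (Φ (y, 0))‖ₑ
          ≤ ‖ψ k (Φ (y, t)) - f (Φ (y, t))‖ₑ + ‖ψ k (Φ (y, 0)) - g (Φ (y, 0))‖ₑ
            + ‖ψ k (Φ (y, t)) - ψ k (Φ (y, 0))‖ₑ := by
            rw [h3]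
            refine (enorm_add_le _ _).trans (add_le_add_left ((enorm_add_le _ _).trans ?_) _)
            rw [enorm_neg]
        _ ≤ _ := by
            rw [add_assoc (_ + _)]
            exact add_le_add_right (h1.trans h2) _
    calc _ ≤ ∫⁻ z in S, (‖ψ k (Φ z) - f (Φ z)‖ₑ + ‖ψ k (Φ (z.1, 0)) - g (Φ (z.1, 0))‖ₑ
          + vertLIntegral Φ I V (gradient (ψ k) - G) z.1) ∂(volume.prod volume) :=
          setLIntegral_mono' hS hpt
      _ = ∫⁻ z in S, ‖ψ k (Φ z) - f (Φ z)‖ₑ ∂(volume.prod volume)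
          + ∫⁻ z in S, ‖ψ k (Φ (z.1, 0)) - g (Φ (z.1, 0))‖ₑ ∂(volume.prod volume)
          + ∫⁻ z in S, vertLIntegral Φ I V (gradient (ψ k) - G) z.1 ∂(volume.prod volume) := by
          rw [lintegral_add_right _ hvm']
          congr 1
          exact lintegral_add_left (hcf.comp hΦ.measurable) _
      _ ≤ _ := by
          refine add_le_add (add_le_add ?_ ?_) ?_
          · rw [eLpNorm_one_eq_lintegral_enorm]
            exact (lintegral_mono_set hSΦ).trans
              (hΦ.setLIntegral_comp_preimage hV hcf).le
          · refine (hfst (hcg.comp hγ)).trans (mul_le_mul_right ?_ _)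
            rw [eLpNorm_one_eq_lintegral_enorm]
            exact (lintegral_map hcg hγ).symm.trans_le (lintegral_mono' hB le_rfl)
          · refine (hfst hvm).trans (mul_le_mul_right ?_ _)
            rw [eLpNorm_one_eq_lintegral_enorm]
            exact (setLIntegral_le_lintegral _ _).trans (lintegral_vertLIntegral_le hΦ I hV hD)
  have hlim : Tendsto (fun k => eLpNorm (fun x => ψ k x - f x) 1 (volume.restrict V)
        + volume I * eLpNorm (fun x => ψ k x - g x) 1 σ
        + volume I * eLpNorm (fun x => gradient (ψ k) x - G x) 1 (volume.restrict V))
      atTop (𝓝 (0 + volume I * 0 + volume I * 0)) :=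
    (hψf.add (ENNReal.Tendsto.const_mul hψg (Or.inr hIt))).add
      (ENNReal.Tendsto.const_mul hψG (Or.inr hIt))
  simp only [mul_zero, add_zero] at hlim
  have h0 := le_antisymm (ge_of_tendsto' hlim hb) zero_le
  rw [lintegral_eq_zero_iff] at h0
  · filter_upwards [h0] with z hz
    exact tsub_eq_zero_iff_le.1 hz
  · exact ((hf.comp_measurable hΦ.measurable).sub
      (hg.comp_measurable (hγ.comp measurable_fst))).enorm.sub
      ((measurable_vertLIntegral hΦ.measurable I hV hG).comp measurable_fst)

/-- The `Lᵖ` norm near the boundary is controlled by the trace and the gradient. -/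
lemma eLpNorm_le_of_ae_enorm_sub_le
    (hΦ : MeasurePreserving Φ (volume.prod volume) volume) {I : Set ℝ} (hI0 : volume I ≠ 0)
    (hIt : volume I ≠ ⊤) {V : Set (Eucl N)} (hV : MeasurableSet V) {B : Set (Eucl m)}
    {σ : Measure (Eucl N)} (hB : (volume.restrict B).map (fun y => Φ (y, 0)) ≤ σ)
    {T : Set (Eucl N)} (hT : MeasurableSet T) (hTB : Φ ⁻¹' T ⊆ B ×ˢ I)
    {f g : Eucl N → ℝ} {G : Eucl N → Eucl N} (hf : StronglyMeasurable f)
    (hg : StronglyMeasurable g) (hG : StronglyMeasurable G)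
    (h : ∀ᵐ z ∂((volume.prod volume).restrict (Φ ⁻¹' T)),
      ‖f (Φ z) - g (Φ (z.1, 0))‖ₑ ≤ vertLIntegral Φ I V G z.1) {p : ℝ≥0∞} (hp : 1 ≤ p) :
    eLpNorm f p (volume.restrict T) ≤ volume I * eLpNorm G p (volume.restrict V)
      + volume I ^ (p⁻¹).toReal * eLpNorm g p σ := by
  have hγ : Measurable fun y : Eucl m => Φ (y, 0) :=
    hΦ.measurable.comp (measurable_id.prodMk measurable_const)
  have hu : (volume.restrict I) Set.univ = volume I := Measure.restrict_apply_univ I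
  have hgγ : StronglyMeasurable fun y => ‖g (Φ (y, 0))‖ₑ :=
    (hg.comp_measurable hγ).enorm.stronglyMeasurable
  have hvm := measurable_vertLIntegral hΦ.measurable I hV hG
  rw [← eLpNorm_comp_measurePreserving hf.aestronglyMeasurable (hΦ.restrict_preimage hT)]
  calc eLpNorm (f ∘ Φ) p ((volume.prod volume).restrict (Φ ⁻¹' T))
      ≤ eLpNorm ((fun z : Eucl m × ℝ => vertLIntegral Φ I V G z.1)
          + fun z : Eucl m × ℝ => ‖g (Φ (z.1, 0))‖ₑ) p
          ((volume.prod volume).restrict (Φ ⁻¹' T)) := by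
        refine eLpNorm_mono_enorm_ae ?_
        filter_upwards [h] with z hz
        simp only [Function.comp_apply, Pi.add_apply, enorm_eq_self]
        calc ‖f (Φ z)‖ₑ = ‖f (Φ z) - g (Φ (z.1, 0)) + g (Φ (z.1, 0))‖ₑ := by simp
          _ ≤ _ := (enorm_add_le _ _).trans (add_le_add_left hz _)
    _ ≤ eLpNorm ((fun z : Eucl m × ℝ => vertLIntegral Φ I V G z.1)
          + fun z : Eucl m × ℝ => ‖g (Φ (z.1, 0))‖ₑ) p
          ((volume.restrict B).prod (volume.restrict I)) := by
        rw [Measure.prod_restrict]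
        exact eLpNorm_mono_measure _ (Measure.restrict_mono hTB le_rfl)
    _ ≤ eLpNorm (fun z : Eucl m × ℝ => vertLIntegral Φ I V G z.1) p
          ((volume.restrict B).prod (volume.restrict I))
        + eLpNorm (fun z : Eucl m × ℝ => ‖g (Φ (z.1, 0))‖ₑ) p
          ((volume.restrict B).prod (volume.restrict I)) :=
        eLpNorm_add_le (hvm.comp measurable_fst).aestronglyMeasurable
          (hgγ.comp_measurable measurable_fst).aestronglyMeasurable hp
    _ ≤ _ := by
        refine add_le_add (eLpNorm_vertLIntegral_fst_le hΦ hI0 hIt B hV hG hp) ?_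
        rw [eLpNorm_comp_fst_prod (by rwa [hu]) hgγ.aestronglyMeasurable, hu, eLpNorm_enorm]
        refine mul_le_mul_right (le_trans (le_of_eq ?_) (eLpNorm_mono_measure g hB)) _
        exact (eLpNorm_map_measure hg.aestronglyMeasurable hγ.aemeasurable).symm

/-- The `Lᵖ` norm of the trace is controlled by the function and its gradient. -/
lemma eLpNorm_trace_le_of_ae_enorm_sub_le
    (hΦ : MeasurePreserving Φ (volume.prod volume) volume) {I : Set ℝ} (hI0 : volume I ≠ 0)
    (hIt : volume I ≠ ⊤) {V : Set (Eucl N)} (hV : MeasurableSet V) {D : Set (Eucl m)}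
    {σ : Measure (Eucl N)} {κ : ℝ≥0}
    (hD : σ ≤ (κ : ℝ≥0∞) • (volume.restrict D).map (fun y => Φ (y, 0)))
    (hDV : D ×ˢ I ⊆ Φ ⁻¹' V)
    {f g : Eucl N → ℝ} {G : Eucl N → Eucl N} (hf : StronglyMeasurable f)
    (hg : StronglyMeasurable g) (hG : StronglyMeasurable G)
    (h : ∀ᵐ z ∂((volume.prod volume).restrict (D ×ˢ I)),
      ‖f (Φ z) - g (Φ (z.1, 0))‖ₑ ≤ vertLIntegral Φ I V G z.1) {p : ℝ≥0∞} (hp : 1 ≤ p) :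
    volume I ^ (p⁻¹).toReal * eLpNorm g p σ
      ≤ (κ : ℝ≥0∞) ^ (p⁻¹).toReal
        * (eLpNorm f p (volume.restrict V) + volume I * eLpNorm G p (volume.restrict V)) := by
  have hγ : Measurable fun y : Eucl m => Φ (y, 0) :=
    hΦ.measurable.comp (measurable_id.prodMk measurable_const)
  have hu : (volume.restrict I) Set.univ = volume I := Measure.restrict_apply_univ I
  have hgγ : StronglyMeasurable fun y => g (Φ (y, 0)) := hg.comp_measurable hγ
  have hfe : StronglyMeasurable fun z => ‖f (Φ z)‖ₑ :=
    (hf.comp_measurable hΦ.measurable).enorm.stronglyMeasurable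
  have hvm := measurable_vertLIntegral hΦ.measurable I hV hG
  -- The constant `κ` scales the measure, hence enters the norm to the power `1/p`.
  have h1 : eLpNorm g p σ
      ≤ (κ : ℝ≥0∞) ^ (p⁻¹).toReal * eLpNorm (fun y => g (Φ (y, 0))) p (volume.restrict D) := by
    refine (eLpNorm_mono_measure g hD).trans ((eLpNorm_smul_measure_le _ _ _ _).trans_eq ?_)
    rw [eLpNorm_map_measure hg.aestronglyMeasurable hγ.aemeasurable, one_div, smul_eq_mul]
    rfl
  have h2 : volume I ^ (p⁻¹).toReal * eLpNorm (fun y => g (Φ (y, 0))) p (volume.restrict D)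
      ≤ eLpNorm f p (volume.restrict V) + volume I * eLpNorm G p (volume.restrict V) := by
    have he := eLpNorm_comp_fst_prod (μ := volume.restrict D) (ν := volume.restrict I)
      (by rwa [hu]) hgγ.aestronglyMeasurable p
    rw [hu] at he
    rw [← he]
    calc _ ≤ eLpNorm ((fun z : Eucl m × ℝ => ‖f (Φ z)‖ₑ)
          + fun z : Eucl m × ℝ => vertLIntegral Φ I V G z.1) p
          ((volume.restrict D).prod (volume.restrict I)) := by
          refine eLpNorm_mono_enorm_ae ?_
          rw [Measure.prod_restrict]
          filter_upwards [h] with z hz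
          simp only [Pi.add_apply, enorm_eq_self]
          calc ‖g (Φ (z.1, 0))‖ₑ = ‖f (Φ z) - (f (Φ z) - g (Φ (z.1, 0)))‖ₑ := by simp
            _ ≤ _ := enorm_sub_le.trans (add_le_add_right hz _)
      _ ≤ eLpNorm (fun z : Eucl m × ℝ => ‖f (Φ z)‖ₑ) p
            ((volume.restrict D).prod (volume.restrict I))
          + eLpNorm (fun z : Eucl m × ℝ => vertLIntegral Φ I V G z.1) p
            ((volume.restrict D).prod (volume.restrict I)) :=
          eLpNorm_add_le hfe.aestronglyMeasurable
            (hvm.comp measurable_fst).aestronglyMeasurable hp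
      _ ≤ _ := by
          refine add_le_add ?_ (eLpNorm_vertLIntegral_fst_le hΦ hI0 hIt D hV hG hp)
          rw [eLpNorm_enorm, Measure.prod_restrict]
          refine (eLpNorm_mono_measure _ (Measure.restrict_mono hDV le_rfl)).trans_eq ?_
          exact eLpNorm_comp_measurePreserving hf.aestronglyMeasurable (hΦ.restrict_preimage hV)
  calc _ ≤ volume I ^ (p⁻¹).toReal * ((κ : ℝ≥0∞) ^ (p⁻¹).toReal
        * eLpNorm (fun y => g (Φ (y, 0))) p (volume.restrict D)) := mul_le_mul_right h1 _
    _ = (κ : ℝ≥0∞) ^ (p⁻¹).toReal * (volume I ^ (p⁻¹).toReal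
        * eLpNorm (fun y => g (Φ (y, 0))) p (volume.restrict D)) := by ring
    _ ≤ _ := mul_le_mul_right h2 _

end Vertical

/-! ### Lipschitz graph charts of the boundary -/

/-- A Lipschitz derivative is bounded on the ball, by its value at the centre plus `K * α`;
convexity and the mean value inequality conclude. -/
lemma IsC11OnBall.exists_lipschitzOnWith {m : ℕ} {φ : Eucl m → ℝ} {α : ℝ} (hα : 0 < α)
    (h : IsC11OnBall φ α) : ∃ L : ℝ≥0, LipschitzOnWith L φ (Metric.ball 0 α) := by
  obtain ⟨hd, K, hK⟩ := h
  refine ⟨‖fderiv ℝ φ 0‖₊ + K * α.toNNReal, ?_⟩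
  refine (convex_ball 0 α).lipschitzOnWith_of_nnnorm_fderiv_le (𝕜 := ℝ) (fun x hx => ?_)
    fun x hx => ?_
  · exact ((hd.differentiableOn (by simp)) x hx).differentiableAt (Metric.isOpen_ball.mem_nhds hx)
  · rw [← NNReal.coe_le_coe]
    push_cast
    have h1 := hK.dist_le_mul x hx 0 (Metric.mem_ball_self hα)
    rw [dist_eq_norm, dist_zero_right] at h1
    have h2 : (K : ℝ) * ‖x‖ ≤ K * max α 0 :=
      mul_le_mul_of_nonneg_left ((mem_ball_zero_iff.1 hx).le.trans (le_max_left _ _)) K.2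
    calc ‖fderiv ℝ φ x‖ = ‖fderiv ℝ φ 0 + (fderiv ℝ φ x - fderiv ℝ φ 0)‖ := by simp
      _ ≤ _ := (norm_add_le _ _).trans (by rw [Real.coe_toNNReal']; linarith)

/-- A segment from a set to its complement meets the frontier. -/
lemma exists_mem_segment_frontier {E : Type*} [NormedAddCommGroup E] [NormedSpace ℝ E]
    {s : Set E} {a b : E} (ha : a ∈ s) (hb : b ∉ s) : ∃ w ∈ segment ℝ a b, w ∈ frontier s := by
  by_contra! h
  have hpre : IsPreconnected (segment ℝ a b) := (convex_segment a b).isPreconnected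
  -- If the segment missed the frontier, the interior and the exterior of `s` would disconnect it.
  have hcov : segment ℝ a b ⊆ interior s ∪ (closure s)ᶜ := by
    intro w hw
    by_contra hw'
    rw [Set.mem_union, not_or, Set.notMem_compl_iff] at hw'
    exact h w hw ⟨hw'.2, hw'.1⟩
  obtain ⟨w, -, hw1, hw2⟩ := hpre _ _ isOpen_interior isClosed_closure.isOpen_compl hcov
    ⟨a, left_mem_segment ℝ a b, (hcov (left_mem_segment ℝ a b)).resolve_right
      fun h' => h' (subset_closure ha)⟩
    ⟨b, right_mem_segment ℝ a b, (hcov (right_mem_segment ℝ a b)).resolve_left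
      fun h' => hb (interior_subset h')⟩
  exact hw2 (subset_closure (interior_subset hw1))

/-- `Φ (y, t)` is the point at signed vertical distance `t` from the point of the boundary `Γ` of
`Ω` with horizontal coordinate `y`; this describes `Γ` over `B` and near `K ⊆ Γ`. -/
structure IsGraphChart {N : ℕ} (Ω : Set (Eucl N)) (δ₀ c : ℝ) (κ : ℝ≥0)
    (Φ : Eucl (N - 1) × ℝ → Eucl N) (v : Eucl N) (B : Set (Eucl (N - 1))) (K : Set (Eucl N)) :
    Prop where
  measurePreserving : MeasurePreserving Φ (volume.prod volume) volume
  lin : ∀ y t, Φ (y, t) = Φ (y, 0) + t • v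
  norm_v : ‖v‖ = 1
  isClosed : IsClosed K
  subset_frontier : K ⊆ frontier Ω
  map_le : (volume.restrict B).map (fun y => Φ (y, 0)) ≤ surfaceMeasure Ω
  le_map : (surfaceMeasure Ω).restrict K
    ≤ (κ : ℝ≥0∞) • (volume.restrict ((fun y => Φ (y, 0)) ⁻¹' K)).map (fun y => Φ (y, 0))
  segment_subset : ∀ δ ≤ δ₀, ∀ y t, Φ (y, t) ∈ Metric.thickening δ K → y ∈ B ∧
    ∀ s ∈ Set.uIcc 0 t, s ∈ Set.Ioo (-(c * δ)) (c * δ) ∧ Φ (y, s) ∈ Metric.thickening δ (frontier Ω)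

/-- The point with local coordinates `(y, φ y + t)`. -/
noncomputable def graphMap {N : ℕ} (A : Eucl N ≃ᵃⁱ[ℝ] LocalCoord N) (φ : Eucl (N - 1) → ℝ)
    (z : Eucl (N - 1) × ℝ) : Eucl N :=
  A.symm (WithLp.toLp 2 (z.1, φ z.1 + z.2))

/-- The unit vector in the direction of the last local coordinate. -/
noncomputable def vertVec {N : ℕ} (A : Eucl N ≃ᵃⁱ[ℝ] LocalCoord N) : Eucl N :=
  A.linearIsometryEquiv.symm (WithLp.toLp 2 (0, 1))

section GraphMap

variable {N : ℕ} (A : Eucl N ≃ᵃⁱ[ℝ] LocalCoord N) (φ : Eucl (N - 1) → ℝ)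

lemma apply_graphMap (z : Eucl (N - 1) × ℝ) :
    A (graphMap A φ z) = WithLp.toLp 2 (z.1, φ z.1 + z.2) := A.apply_symm_apply _

lemma fst_apply_graphMap (z : Eucl (N - 1) × ℝ) : (A (graphMap A φ z)).fst = z.1 := by
  rw [apply_graphMap]; rfl

lemma snd_apply_graphMap (z : Eucl (N - 1) × ℝ) : (A (graphMap A φ z)).snd = φ z.1 + z.2 := by
  rw [apply_graphMap]; rfl

lemma norm_vertVec : ‖vertVec A‖ = 1 := by
  rw [vertVec, LinearIsometryEquiv.norm_map, WithLp.prod_norm_eq_of_L2]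
  simp

lemma apply_add_smul_vertVec (x : Eucl N) (t : ℝ) :
    A (x + t • vertVec A) = A x + WithLp.toLp 2 (0, t) := by
  have h := A.map_vadd x (t • vertVec A)
  rw [vadd_eq_add, vadd_eq_add, add_comm] at h
  rw [h, map_smul, vertVec, LinearIsometryEquiv.apply_symm_apply, add_comm, ← WithLp.toLp_smul]
  simp

lemma graphMap_eq_add (y : Eucl (N - 1)) (t : ℝ) :
    graphMap A φ (y, t) = graphMap A φ (y, 0) + t • vertVec A := by
  apply A.injective
  rw [apply_add_smul_vertVec, apply_graphMap, apply_graphMap, ← WithLp.toLp_add]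
  simp

/-- On each vertical line the shear is a translation, so Fubini gives invariance with no
differentiability of `φ`; the rigid motion preserves volume because volume is the full-dimensional
Hausdorff measure. -/
lemma measurePreserving_graphMap (hφ : Measurable φ) :
    MeasurePreserving (graphMap A φ) (volume.prod volume) volume := by
  have h1 : MeasurePreserving (fun z : Eucl (N - 1) × ℝ => (z.1, φ z.1 + z.2))
      (volume.prod volume) (volume.prod volume) :=
    (MeasurePreserving.id volume).skew_product (g := fun y t => φ y + t)
      ((hφ.comp measurable_fst).add measurable_snd)
      (ae_of_all _ fun y => (measurePreserving_add_left volume (φ y)).map_eq)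
  have h2 := WithLp.volume_preserving_toLp (Eucl (N - 1)) ℝ
  have h3 : MeasurePreserving A.symm (volume : Measure (LocalCoord N)) volume := by
    have h := A.symm.toIsometryEquiv.measurePreserving_euclideanHausdorffMeasure
      (Module.finrank ℝ (Eucl N))
    rw [InnerProductSpace.euclideanHausdorffMeasure_eq_volume,
      A.linearIsometryEquiv.toLinearEquiv.finrank_eq,
      InnerProductSpace.euclideanHausdorffMeasure_eq_volume] at h
    exact h
  exact h3.comp (h2.comp h1)

lemma lipschitzWith_graphMap_zero {L : ℝ≥0} (hφ : LipschitzWith L φ) :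
    LipschitzWith (1 + L) fun y => graphMap A φ (y, 0) := by
  refine LipschitzWith.of_dist_le_mul fun y y' => ?_
  rw [← A.isometry.dist_eq, apply_graphMap, apply_graphMap, WithLp.prod_dist_eq_of_L2]
  refine Real.sqrt_le_iff.2 ⟨by positivity, ?_⟩
  have h := hφ.dist_le_mul y y'
  have h0 : 0 ≤ (L : ℝ) := L.2
  simp only [add_zero]
  change dist y y' ^ 2 + dist (φ y) (φ y') ^ 2 ≤ _
  have h2 : dist (φ y) (φ y') ^ 2 ≤ (L * dist y y') ^ 2 := by gcongr
  push_cast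
  nlinarith [mul_nonneg h0 (sq_nonneg (dist y y'))]

lemma lipschitzWith_fst_apply : LipschitzWith 1 fun x => (A x).fst := by
  refine LipschitzWith.of_dist_le_mul fun x x' => ?_
  rw [← A.isometry.dist_eq x x', WithLp.prod_dist_eq_of_L2, NNReal.coe_one, one_mul]
  exact Real.le_sqrt_of_sq_le (by nlinarith [sq_nonneg (dist (A x).snd (A x').snd)])

lemma lipschitzWith_snd_apply : LipschitzWith 1 fun x => (A x).snd := by
  refine LipschitzWith.of_dist_le_mul fun x x' => ?_
  rw [← A.isometry.dist_eq x x', WithLp.prod_dist_eq_of_L2, NNReal.coe_one, one_mul]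
  exact Real.le_sqrt_of_sq_le (by nlinarith [sq_nonneg (dist (A x).fst (A x').fst)])

end GraphMap

/-- The normalizing constant depends only on `d`, so it is the same on both sides. This takes the
place of an area formula when surface measure is compared with Lebesgue measure in the parameter
domain. -/
lemma LipschitzOnWith.euclideanHausdorffMeasure_image_le {X Y : Type*} [EMetricSpace X]
    [MeasurableSpace X] [BorelSpace X] [EMetricSpace Y] [MeasurableSpace Y] [BorelSpace Y]
    {K : ℝ≥0} {f : X → Y} {s : Set X} (hf : LipschitzOnWith K f s) (d : ℕ) :
    (Measure.euclideanHausdorffMeasure d : Measure Y) (f '' s)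
      ≤ (K : ℝ≥0∞) ^ d * (Measure.euclideanHausdorffMeasure d : Measure X) s := by
  simp only [Measure.euclideanHausdorffMeasure_def, Measure.smul_apply, ENNReal.smul_def,
    smul_eq_mul]
  have h := hf.hausdorffMeasure_image_le (d := d) (by positivity)
  rw [ENNReal.rpow_natCast] at h
  calc _ ≤ _ := mul_le_mul_right h _
    _ = _ := by ring

lemma isOpen_chartNbhd {N : ℕ} (A : Eucl N ≃ᵃⁱ[ℝ] LocalCoord N) {φ : Eucl (N - 1) → ℝ}
    (hφ : Continuous φ) (α β : ℝ) : IsOpen (chartNbhd A φ α β) := by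
  have h1 := (lipschitzWith_fst_apply A).continuous
  have h2 := (lipschitzWith_snd_apply A).continuous
  exact (isOpen_lt h1.norm continuous_const).inter
    (isOpen_lt (h2.sub (hφ.comp h1)).abs continuous_const)

/-- A Lipschitz graph chart of the boundary, in the part of the boundary at distance at least `ε`
from the end of its coordinate neighbourhood. -/
lemma isGraphChart_of_chartNbhd {N : ℕ} {Ω : Set (Eucl N)} {A : Eucl N ≃ᵃⁱ[ℝ] LocalCoord N}
    {φ : Eucl (N - 1) → ℝ} {L : ℝ≥0} (hφ : LipschitzWith L φ) {α β : ℝ}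
    (hΓ : frontier Ω ∩ chartNbhd A φ α β = {x | ‖(A x).fst‖ < α ∧ (A x).snd = φ (A x).fst})
    (hin : Ω ∩ chartNbhd A φ α β =
        {x | ‖(A x).fst‖ < α ∧ φ (A x).fst < (A x).snd ∧ (A x).snd < φ (A x).fst + β})
    (hout : (closure Ω)ᶜ ∩ chartNbhd A φ α β =
        {x | ‖(A x).fst‖ < α ∧ φ (A x).fst - β < (A x).snd ∧ (A x).snd < φ (A x).fst})
    {ε : ℝ} (hε : 0 < ε) :
    IsGraphChart Ω (ε / (2 + L)) (1 + L) ((1 + L) ^ (N - 1)) (graphMap A φ) (vertVec A)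
      (Metric.ball 0 α) {z | z ∈ frontier Ω ∧ Metric.ball z ε ⊆ chartNbhd A φ α β} := by
  set U := chartNbhd A φ α β
  set K : Set (Eucl N) := {z | z ∈ frontier Ω ∧ Metric.ball z ε ⊆ U}
  have hγL := lipschitzWith_graphMap_zero A φ hφ
  have hγm : Measurable fun y => graphMap A φ (y, 0) := hγL.continuous.measurable
  have hKc : IsClosed K := by
    refine isClosed_frontier.inter (isClosed_of_closure_subset fun z hz w hw => ?_)
    -- A point `w` of the open ball has slack `ε - dist w z`, so it also lies in the ball around any
    -- sufficiently close `z'`.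
    obtain ⟨z', hz', hd⟩ := Metric.mem_closure_iff.1 hz (ε - dist w z)
      (sub_pos.2 (Metric.mem_ball.1 hw))
    refine hz' (Metric.mem_ball.2 ?_)
    linarith [dist_triangle w z z']
  have hpΓ : ∀ y ∈ Metric.ball (0 : Eucl (N - 1)) α, graphMap A φ (y, 0) ∈ frontier Ω := by
    intro y hy
    have : graphMap A φ (y, 0) ∈ frontier Ω ∩ U := by
      rw [hΓ]
      refine ⟨?_, ?_⟩
      · rw [fst_apply_graphMap]; exact mem_ball_zero_iff.1 hy
      · rw [fst_apply_graphMap, snd_apply_graphMap, add_zero]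
    exact this.1
  have hKU : ∀ z ∈ K, z ∈ U := fun z hz => hz.2 (Metric.mem_ball_self hε)
  have hgr : ∀ x ∈ frontier Ω, x ∈ U → graphMap A φ ((A x).fst, 0) = x := by
    intro x hx hxU
    have h : x ∈ frontier Ω ∩ U := ⟨hx, hxU⟩
    rw [hΓ] at h
    apply A.injective
    rw [apply_graphMap, add_zero, ← h.2]
    rfl
  have hvol : (Measure.euclideanHausdorffMeasure (N - 1) : Measure (Eucl (N - 1))) = volume :=
    EuclideanSpace.euclideanHausdorffMeasure_eq_volume _
  refine ⟨measurePreserving_graphMap A φ hφ.continuous.measurable, graphMap_eq_add A φ,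
    norm_vertVec A, hKc, fun z hz => hz.1, ?_, ?_, ?_⟩
  -- The horizontal projection is 1-Lipschitz and undoes the parametrization, so it does not
  -- increase measure.
  · refine Measure.le_iff.2 fun s hs => ?_
    rw [Measure.map_apply hγm hs, Measure.restrict_apply (hγm hs), surfaceMeasure,
      Measure.restrict_apply hs, ← hvol]
    calc _ ≤ Measure.euclideanHausdorffMeasure (N - 1)
          ((fun x => (A x).fst) '' (s ∩ frontier Ω)) := by
          refine measure_mono fun y hy => ⟨graphMap A φ (y, 0), ⟨hy.1, hpΓ y hy.2⟩, ?_⟩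
          exact fst_apply_graphMap A φ _
      _ ≤ _ := (lipschitzWith_fst_apply A).lipschitzOnWith.euclideanHausdorffMeasure_image_le _
      _ = _ := by simp
  -- The parametrization is `(1 + L)`-Lipschitz, whence the factor `(1 + L) ^ (N - 1)`.
  · refine Measure.le_iff.2 fun s hs => ?_
    rw [Measure.smul_apply, Measure.map_apply hγm hs, Measure.restrict_apply (hγm hs),
      Measure.restrict_apply hs, surfaceMeasure, Measure.restrict_apply (hs.inter
      hKc.measurableSet), ← hvol, smul_eq_mul]
    calc _ ≤ Measure.euclideanHausdorffMeasure (N - 1) ((fun y => graphMap A φ (y, 0)) ''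
          ((fun y => graphMap A φ (y, 0)) ⁻¹' s ∩ (fun y => graphMap A φ (y, 0)) ⁻¹' K)) := by
          refine measure_mono fun x hx => ?_
          have h := hgr x hx.2 (hKU x hx.1.2)
          refine ⟨(A x).fst, ⟨?_, ?_⟩, h⟩
          · simpa only [Set.mem_preimage, h] using hx.1.1
          · simpa only [Set.mem_preimage, h] using hx.1.2
      _ ≤ _ := hγL.lipschitzOnWith.euclideanHausdorffMeasure_image_le _
      _ = _ := by push_cast; rfl
  · intro δ hδ y t hyt
    obtain ⟨z, hzK, hxz⟩ := Metric.mem_thickening_iff.1 hyt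
    set x := graphMap A φ (y, t)
    have hδ0 : 0 < δ := dist_nonneg.trans_lt hxz
    have hL0 : 0 ≤ (L : ℝ) := L.2
    -- The budget for staying in the chart: `δ` from `x` to `z`, then at most `(1 + L) * δ` of
    -- vertical sliding.
    have hδε : (2 + L) * δ ≤ ε := by
      rw [le_div_iff₀ (by positivity)] at hδ
      linarith
    have hLδ : 0 ≤ L * δ := by positivity
    have hxU : x ∈ U := hzK.2 (by rw [Metric.mem_ball]; linarith)
    have hx1 : (A x).fst = y := fst_apply_graphMap A φ _
    have hx2 : (A x).snd = φ y + t := snd_apply_graphMap A φ _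
    have hzg : z ∈ frontier Ω ∩ U := ⟨hzK.1, hKU z hzK⟩
    rw [hΓ] at hzg
    have hy : ‖y‖ < α := hx1 ▸ hxU.1
    have d1 := (lipschitzWith_fst_apply A).dist_le_mul x z
    have d2 := (lipschitzWith_snd_apply A).dist_le_mul x z
    have d3 := hφ.dist_le_mul y (A z).fst
    rw [NNReal.coe_one, one_mul] at d1 d2
    rw [hx1] at d1
    rw [hx2, hzg.2, Real.dist_eq] at d2
    rw [Real.dist_eq] at d3
    have d4 : L * dist y (A z).fst ≤ L * δ :=
      mul_le_mul_of_nonneg_left (d1.trans hxz.le) hL0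
    -- The height differs by less than `δ` from that of `z`, and the graph varies by at most `L * δ`
    -- between the two base points.
    have ht : |t| < (1 + L) * δ := by
      have : |t| ≤ |φ y + t - φ (A z).fst| + |φ y - φ (A z).fst| := by
        calc |t| = |(φ y + t - φ (A z).fst) - (φ y - φ (A z).fst)| := by ring_nf
          _ ≤ _ := abs_sub _ _
      linarith
    refine ⟨mem_ball_zero_iff.2 hy, fun s hs => ?_⟩
    have hst : |s| ≤ |t| ∧ |s - t| ≤ |t| := by
      rcases Set.mem_uIcc.1 hs with ⟨h1, h2⟩ | ⟨h1, h2⟩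
      · rw [abs_of_nonneg h1, abs_of_nonneg (h1.trans h2), abs_of_nonpos (by linarith)]
        constructor <;> linarith
      · rw [abs_of_nonpos h2, abs_of_nonpos (h1.trans h2), abs_of_nonneg (by linarith)]
        constructor <;> linarith
    refine ⟨abs_lt.1 (hst.1.trans_lt ht), ?_⟩
    set xs := graphMap A φ (y, s) with hxs_def
    -- Sliding `x` and `z` by the same vector keeps their distance below `δ`. If `s` is strictly
    -- between 0 and `t`, then `xs` has height `s` over the graph and `zs` has height `s - t`, of
    -- the opposite sign.
    set zs := z + (s - t) • vertVec A
    have hxs : xs = x + (s - t) • vertVec A := by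
      rw [hxs_def, graphMap_eq_add A φ y s, show x = _ from graphMap_eq_add A φ y t, add_assoc,
        ← add_smul]
      congr 2
      ring
    have hshift : ∀ w : Eucl N, dist (w + (s - t) • vertVec A) w < (1 + L) * δ := by
      intro w
      rw [dist_eq_norm, add_sub_cancel_left, norm_smul, norm_vertVec, mul_one, Real.norm_eq_abs]
      exact hst.2.trans_lt ht
    have hdz : dist xs zs = dist x z := by rw [hxs]; exact dist_add_right _ _ _
    have hxsU : xs ∈ U := hzK.2 (by
      have h1 := hshift x
      rw [← hxs] at h1
      rw [Metric.mem_ball]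
      linarith [dist_triangle xs x z])
    have hzsU : zs ∈ U := hzK.2 (by
      have h1 : dist zs z < (1 + L) * δ := hshift z
      rw [Metric.mem_ball]
      linarith)
    have hx1s : (A xs).fst = y := fst_apply_graphMap A φ _
    have hx2s : (A xs).snd = φ y + s := snd_apply_graphMap A φ _
    have hAzs : A zs = A z + WithLp.toLp 2 (0, s - t) := apply_add_smul_vertVec A z (s - t)
    have hz1s : (A zs).fst = (A z).fst := by rw [hAzs]; simp
    have hz2s : (A zs).snd = φ (A z).fst + (s - t) := by rw [hAzs, ← hzg.2]; simp
    have above : ∀ w ∈ U, φ (A w).fst < (A w).snd → w ∈ Ω := by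
      intro w hw h
      have : w ∈ Ω ∩ U := by
        rw [hin]
        exact ⟨hw.1, h, by linarith [(abs_lt.1 hw.2).2]⟩
      exact this.1
    have below : ∀ w ∈ U, (A w).snd < φ (A w).fst → w ∉ Ω := by
      intro w hw h hwΩ
      have : w ∈ (closure Ω)ᶜ ∩ U := by
        rw [hout]
        exact ⟨hw.1, by linarith [(abs_lt.1 hw.2).1], h⟩
      exact this.1 (subset_closure hwΩ)
    have cross : ∀ w ∈ segment ℝ xs zs, w ∈ frontier Ω → xs ∈ Metric.thickening δ (frontier Ω) := by
      intro w hw hwΓ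
      refine Metric.mem_thickening_iff.2 ⟨w, hwΓ, ?_⟩
      have := dist_add_dist_of_mem_segment hw
      linarith [dist_nonneg (x := w) (y := zs)]
    rcases eq_or_ne s t with rfl | hne
    · exact Metric.mem_thickening_iff.2 ⟨z, hzK.1, hxz⟩
    rcases eq_or_ne s 0 with rfl | hs0
    · exact cross xs (left_mem_segment ℝ _ _) (hpΓ y (mem_ball_zero_iff.2 hy))
    rcases Set.mem_uIcc.1 hs with ⟨h1, h2⟩ | ⟨h1, h2⟩
    · have h1 := lt_of_le_of_ne h1 hs0.symm
      have h2 := lt_of_le_of_ne h2 hne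
      obtain ⟨w, hw, hwΓ⟩ := exists_mem_segment_frontier
        (above xs hxsU (by rw [hx1s, hx2s]; linarith))
        (below zs hzsU (by rw [hz1s, hz2s]; linarith))
      exact cross w hw hwΓ
    · have h1 := lt_of_le_of_ne h1 hne.symm
      have h2 := lt_of_le_of_ne h2 hs0
      obtain ⟨w, hw, hwΓ⟩ := exists_mem_segment_frontier
        (above zs hzsU (by rw [hz1s, hz2s]; linarith))
        (below xs hxsU (by rw [hx1s, hx2s]; linarith))
      exact cross w (by rwa [segment_symm]) hwΓ

/-- A bounded `C^{1,1}` boundary is covered by finitely many graph charts. -/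
lemma HasC11Boundary.exists_isGraphChart {N : ℕ} {Ω : Set (Eucl N)} (hΩ : HasC11Boundary Ω)
    (hΩb : Bornology.IsBounded Ω) :
    ∃ (M : ℕ) (δ₀ c : ℝ) (κ : ℝ≥0) (Φ : Fin M → Eucl (N - 1) × ℝ → Eucl N) (v : Fin M → Eucl N)
      (B : Fin M → Set (Eucl (N - 1))) (K : Fin M → Set (Eucl N)), 0 < δ₀ ∧ 1 ≤ c ∧
      (∀ r, IsGraphChart Ω δ₀ c κ (Φ r) (v r) (B r) (K r)) ∧ frontier Ω = ⋃ r, K r := by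
  obtain ⟨M, A, φ, α, β, hα, -, hcov, h⟩ := hΩ
  choose L hL using fun r => (h r).1.exists_lipschitzOnWith hα
  set L₀ : ℝ≥0 := Finset.univ.sup L
  have hL₀ : ∀ r, LipschitzOnWith L₀ (φ r) (Metric.ball 0 α) := fun r =>
    (hL r).weaken (Finset.le_sup (Finset.mem_univ r))
  -- Extending to a globally Lipschitz function makes the chart map defined and measurable
  -- everywhere; over the ball nothing changes, so the coordinate neighbourhoods stay the same.
  choose φ' hφ' heq using fun r => (hL₀ r).extend_real
  have heq' : ∀ (r : Fin M) (x : Eucl N), ‖(A r x).fst‖ < α →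
      φ r (A r x).fst = φ' r (A r x).fst :=
    fun r x hx => heq r (mem_ball_zero_iff.2 hx)
  have hU : ∀ r, chartNbhd (A r) (φ r) α β = chartNbhd (A r) (φ' r) α β := fun r =>
    Set.ext fun x => and_congr_right fun hx => by rw [heq' r x hx]
  have hcomp : IsCompact (frontier Ω) :=
    Metric.isCompact_of_isClosed_isBounded isClosed_frontier
      (hΩb.closure.subset frontier_subset_closure)
  -- The Lebesgue number gives a uniform margin `ε` around every boundary point inside some chart,
  -- so the closed pieces `K r` still cover Γ.
  obtain ⟨ε, hε, hball⟩ := lebesgue_number_lemma_of_metric hcomp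
    (fun r => isOpen_chartNbhd (A r) (hφ' r).continuous α β) (by simpa only [hU] using hcov)
  refine ⟨M, ε / (2 + L₀), 1 + L₀, (1 + L₀) ^ (N - 1), fun r => graphMap (A r) (φ' r),
    fun r => vertVec (A r), fun _ => Metric.ball 0 α,
    fun r => {z | z ∈ frontier Ω ∧ Metric.ball z ε ⊆ chartNbhd (A r) (φ' r) α β},
    by positivity, le_add_of_nonneg_right L₀.2, fun r => ?_, ?_⟩
  · obtain ⟨-, h1, h2, h3⟩ := h r
    rw [hU] at h1 h2 h3
    refine isGraphChart_of_chartNbhd (hφ' r) (h1.trans ?_) (h2.trans ?_) (h3.trans ?_) hε <;>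
      exact Set.ext fun x => and_congr_right fun hx => by rw [heq' r x hx]
  · refine Set.Subset.antisymm (fun z hz => ?_) (Set.iUnion_subset fun r z hz => hz.1)
    obtain ⟨r, hr⟩ := hball z hz
    exact Set.mem_iUnion.2 ⟨r, hz, hr⟩

/-! ### Estimates over the whole boundary, and the trace -/

/-- The indicator of the union is at most the sum of the indicators; then Minkowski, valid up to
infinity. -/
lemma eLpNorm_restrict_iUnion_le {α F ι : Type*} [MeasurableSpace α] [NormedAddCommGroup F]
    [Fintype ι] {μ : Measure α} {f : α → F} (hf : AEStronglyMeasurable f μ) {s : ι → Set α}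
    (hs : ∀ i, MeasurableSet (s i)) {p : ℝ≥0∞} (hp : 1 ≤ p) :
    eLpNorm f p (μ.restrict (⋃ i, s i)) ≤ ∑ i, eLpNorm f p (μ.restrict (s i)) := by
  calc eLpNorm f p (μ.restrict (⋃ i, s i))
      = eLpNorm ((⋃ i, s i).indicator fun x => ‖f x‖) p μ := by
        rw [eLpNorm_indicator_eq_eLpNorm_restrict (MeasurableSet.iUnion hs), eLpNorm_norm]
    _ ≤ eLpNorm (∑ i, (s i).indicator fun x => ‖f x‖) p μ := by
        refine eLpNorm_mono fun x => ?_
        have hnn : ∀ i, 0 ≤ (s i).indicator (fun x => ‖f x‖) x := fun i =>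
          Set.indicator_nonneg (fun _ _ => norm_nonneg _) x
        rw [Finset.sum_apply, Real.norm_of_nonneg (Finset.sum_nonneg fun i _ => hnn i),
          Real.norm_of_nonneg (Set.indicator_nonneg (fun _ _ => norm_nonneg _) x)]
        by_cases hx : x ∈ ⋃ i, s i
        · obtain ⟨i, hi⟩ := Set.mem_iUnion.1 hx
          rw [Set.indicator_of_mem hx]
          refine le_trans ?_ (Finset.single_le_sum (fun i _ => hnn i) (Finset.mem_univ i))
          rw [Set.indicator_of_mem hi]
        · rw [Set.indicator_of_notMem hx]
          exact Finset.sum_nonneg fun i _ => hnn i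
    _ ≤ ∑ i, eLpNorm ((s i).indicator fun x => ‖f x‖) p μ :=
        eLpNorm_sum_le (fun i _ => hf.norm.indicator (hs i)) hp
    _ = _ := Finset.sum_congr rfl fun i _ => by
        rw [eLpNorm_indicator_eq_eLpNorm_restrict (hs i), eLpNorm_norm]

lemma gradient_sub_of_contDiff {N : ℕ} {ψ χ : Eucl N → ℝ} (hψ : ContDiff ℝ ∞ ψ)
    (hχ : ContDiff ℝ ∞ χ) (x : Eucl N) :
    gradient (fun x => ψ x - χ x) x = gradient ψ x - gradient χ x := by
  have h : fderiv ℝ (fun x => ψ x - χ x) x = fderiv ℝ ψ x - fderiv ℝ χ x :=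
    fderiv_fun_sub (hψ.differentiable (by simp)).differentiableAt
      (hχ.differentiable (by simp)).differentiableAt
  simp [gradient, h]

/-- Smooth functions converging to `f` in `W^{1,1}(V)` and to `g` in `L¹` of the boundary. -/
structure IsTraceApprox {N : ℕ} (Ω V : Set (Eucl N)) (f : Eucl N → ℝ) (G : Eucl N → Eucl N)
    (g : Eucl N → ℝ) (ψ : ℕ → Eucl N → ℝ) : Prop where
  contDiff : ∀ k, ContDiff ℝ ∞ (ψ k)
  tendsto : Tendsto (fun k => eLpNorm (fun x => ψ k x - f x) 1 (volume.restrict V)) atTop (𝓝 0)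
  tendsto_gradient : Tendsto (fun k => eLpNorm (fun x => gradient (ψ k) x - G x) 1
    (volume.restrict V)) atTop (𝓝 0)
  tendsto_trace : Tendsto (fun k => eLpNorm (fun x => ψ k x - g x) 1 (surfaceMeasure Ω))
    atTop (𝓝 0)

lemma IsTraceApprox.congr {N : ℕ} {Ω V : Set (Eucl N)} {f f' g g' : Eucl N → ℝ}
    {G G' : Eucl N → Eucl N} {ψ : ℕ → Eucl N → ℝ} (h : IsTraceApprox Ω V f G g ψ)
    (hf : f =ᵐ[volume.restrict V] f') (hG : G =ᵐ[volume.restrict V] G')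
    (hg : g =ᵐ[surfaceMeasure Ω] g') : IsTraceApprox Ω V f' G' g' ψ := by
  refine ⟨h.contDiff, h.tendsto.congr fun k => eLpNorm_congr_ae ?_,
    h.tendsto_gradient.congr fun k => eLpNorm_congr_ae ?_,
    h.tendsto_trace.congr fun k => eLpNorm_congr_ae ?_⟩
  · filter_upwards [hf] with x hx using by rw [hx]
  · filter_upwards [hG] with x hx using by rw [hx]
  · filter_upwards [hg] with x hx using by rw [hx]

/-- Makes a smooth function its own trace, so that the trace inequality applies to differences of
approximants. -/
lemma isTraceApprox_const {N : ℕ} (Ω V : Set (Eucl N)) {ψ : Eucl N → ℝ} (hψ : ContDiff ℝ ∞ ψ) :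
    IsTraceApprox Ω V ψ (gradient ψ) ψ fun _ => ψ := by
  refine ⟨fun _ => hψ, ?_, ?_, ?_⟩ <;> simp

lemma volume_Ioo_neg_self (a : ℝ) : volume (Set.Ioo (-a) a) = ENNReal.ofReal (2 * a) := by
  rw [Real.volume_Ioo]
  congr 1
  ring

section Charts

variable {N : ℕ} {Ω : Set (Eucl N)} {M : ℕ} {δ₀ c : ℝ} {κ : ℝ≥0}
  {Φ : Fin M → Eucl (N - 1) × ℝ → Eucl N} {v : Fin M → Eucl N}
  {B : Fin M → Set (Eucl (N - 1))} {K : Fin M → Set (Eucl N)}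

/-- The `Lᵖ` norm of the trace is bounded by the `W^{1,p}` norm near the boundary. -/
lemma exists_eLpNorm_trace_le (hδ₀ : 0 < δ₀)
    (hch : ∀ r, IsGraphChart Ω δ₀ c κ (Φ r) (v r) (B r) (K r)) (hK : frontier Ω = ⋃ r, K r)
    {τ : ℝ} (hτ : 0 < τ) {p : ℝ≥0∞} (hp : 1 ≤ p) :
    ∃ C : ℝ≥0∞, C ≠ ⊤ ∧ ∀ V : Set (Eucl N), MeasurableSet V →
      Metric.thickening τ (frontier Ω) ⊆ V → ∀ (f g : Eucl N → ℝ) (G : Eucl N → Eucl N)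
      (ψ : ℕ → Eucl N → ℝ), StronglyMeasurable f → StronglyMeasurable g → StronglyMeasurable G →
      IsTraceApprox Ω V f G g ψ →
      eLpNorm g p (surfaceMeasure Ω)
        ≤ C * (eLpNorm f p (volume.restrict V) + eLpNorm G p (volume.restrict V)) := by
  set I : Set ℝ := Set.Ioo (-τ) τ
  have hI : volume I = ENNReal.ofReal (2 * τ) := volume_Ioo_neg_self τ
  have hI0 : volume I ≠ 0 := by rw [hI]; simpa using hτ
  have hIt : volume I ≠ ⊤ := by rw [hI]; exact ENNReal.ofReal_ne_top
  have hIp0 : volume I ^ (p⁻¹).toReal ≠ 0 := (ENNReal.rpow_pos hI0.bot_lt hIt).ne'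
  have hIpt : volume I ^ (p⁻¹).toReal ≠ ⊤ := ENNReal.rpow_ne_top_of_nonneg (by positivity) hIt
  set C₁ : ℝ≥0∞ := (volume I ^ (p⁻¹).toReal)⁻¹ * ((κ : ℝ≥0∞) ^ (p⁻¹).toReal * (1 + volume I))
  refine ⟨M * C₁, ?_, ?_⟩
  · refine ENNReal.mul_ne_top (by simp) (ENNReal.mul_ne_top (by simpa using hIp0)
      (ENNReal.mul_ne_top (ENNReal.rpow_ne_top_of_nonneg (by positivity) (by simp)) (by simp [hIt])))
  intro V hV hτV f g G ψ hf hg hG hψ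
  have hone : ∀ r, eLpNorm g p ((surfaceMeasure Ω).restrict (K r))
      ≤ C₁ * (eLpNorm f p (volume.restrict V) + eLpNorm G p (volume.restrict V)) := by
    intro r
    have hr := hch r
    set D : Set (Eucl (N - 1)) := (fun y => Φ r (y, 0)) ⁻¹' K r
    have hγm : Measurable fun y => Φ r (y, 0) :=
      hr.measurePreserving.measurable.comp (measurable_id.prodMk measurable_const)
    have hDm : MeasurableSet D := hγm hr.isClosed.measurableSet
    -- The segment property at `t = 0` is used only to see that the base point lies in `B r`.
    have hDB : ∀ y ∈ D, y ∈ B r := fun y hy =>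
      (hr.segment_subset δ₀ le_rfl y 0 (Metric.self_subset_thickening hδ₀ _ hy)).1
    have hDV : ∀ y ∈ D, ∀ s ∈ I, Φ r (y, s) ∈ V := by
      intro y hy s hs
      refine hτV (Metric.mem_thickening_iff.2 ⟨_, hr.subset_frontier hy, ?_⟩)
      rw [hr.lin y s, dist_eq_norm, add_sub_cancel_left, norm_smul, hr.norm_v, mul_one]
      exact abs_lt.2 hs
    have h0I : (0 : ℝ) ∈ I := ⟨by linarith, hτ⟩
    have hae := ae_enorm_sub_le_vertLIntegral hr.measurePreserving hr.lin hr.norm_v hIt hV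
      hr.map_le (hDm.prod measurableSet_Ioo) (fun y t hyt => ⟨hDB y hyt.1, fun s hs =>
        have hsI : s ∈ I := Set.ordConnected_Ioo.uIcc_subset h0I hyt.2 hs
        ⟨hsI, hDV y hyt.1 s hsI⟩⟩) hf hg hG hψ.contDiff hψ.tendsto hψ.tendsto_gradient
      hψ.tendsto_trace
    have h := eLpNorm_trace_le_of_ae_enorm_sub_le hr.measurePreserving hI0 hIt hV hr.le_map
      (fun z hz => hDV z.1 hz.1 z.2 hz.2) hf hg hG hae hp
    rw [ENNReal.mul_le_iff_le_inv hIp0 hIpt] at h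
    refine h.trans ?_
    rw [mul_assoc, mul_assoc]
    gcongr
    rw [add_mul, one_mul]
    gcongr
    · exact self_le_add_right _ _
    · exact self_le_add_left _ _
  have hσ : surfaceMeasure Ω = (surfaceMeasure Ω).restrict (⋃ r, K r) := by
    rw [← hK, surfaceMeasure, Measure.restrict_restrict isClosed_frontier.measurableSet,
      Set.inter_self]
  rw [hσ]
  calc _ ≤ ∑ r, eLpNorm g p ((surfaceMeasure Ω).restrict (K r)) :=
        eLpNorm_restrict_iUnion_le hg.aestronglyMeasurable
          (fun r => (hch r).isClosed.measurableSet) hp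
    _ ≤ ∑ _r : Fin M, C₁ * (eLpNorm f p (volume.restrict V) + eLpNorm G p (volume.restrict V)) :=
        Finset.sum_le_sum fun r _ => hone r
    _ = _ := by simp [mul_assoc]

/-- The estimate of a function near the boundary by its trace and its gradient. -/
lemma eLpNorm_thickening_le (hc : 1 ≤ c)
    (hch : ∀ r, IsGraphChart Ω δ₀ c κ (Φ r) (v r) (B r) (K r)) (hK : frontier Ω = ⋃ r, K r)
    {δ : ℝ} (hδ : 0 < δ) (hδδ₀ : δ ≤ δ₀) {p : ℝ≥0∞} (hp : 1 ≤ p) {f g : Eucl N → ℝ}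
    {G : Eucl N → Eucl N} {ψ : ℕ → Eucl N → ℝ} (hf : StronglyMeasurable f)
    (hg : StronglyMeasurable g) (hG : StronglyMeasurable G)
    (hψ : ∀ δ' < δ, IsTraceApprox Ω (Metric.thickening δ' (frontier Ω)) f G g ψ) :
    eLpNorm f p (volume.restrict (Metric.thickening δ (frontier Ω)))
      ≤ ((M * (2 * c).toNNReal : ℝ≥0) : ℝ≥0∞)
        * (ENNReal.ofReal δ * eLpNorm G p (volume.restrict (Metric.thickening δ (frontier Ω)))
          + ENNReal.ofReal δ ^ (p⁻¹).toReal * eLpNorm g p (surfaceMeasure Ω)) := by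
  have hcδ : 0 < c * δ := by positivity
  set I : Set ℝ := Set.Ioo (-(c * δ)) (c * δ)
  set V := Metric.thickening δ (frontier Ω)
  have hV : MeasurableSet V := Metric.isOpen_thickening.measurableSet
  have hI : volume I = ENNReal.ofReal (2 * c) * ENNReal.ofReal δ := by
    rw [volume_Ioo_neg_self, ← mul_assoc, ENNReal.ofReal_mul (by positivity)]
  have hI0 : volume I ≠ 0 := by
    rw [hI]
    exact mul_ne_zero (by simp; linarith) (by simpa using hδ)
  have hIt : volume I ≠ ⊤ := by
    rw [hI]
    exact ENNReal.mul_ne_top ENNReal.ofReal_ne_top ENNReal.ofReal_ne_top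
  have h2c : 1 ≤ ENNReal.ofReal (2 * c) := by
    rw [← ENNReal.ofReal_one]
    exact ENNReal.ofReal_le_ofReal (by linarith)
  -- The approximation is available only on thickenings smaller than `δ`; these exhaust the full
  -- one, and countably many null sets are discarded.
  obtain ⟨u, -, hu, hut⟩ := exists_seq_strictMono_tendsto δ
  have hone : ∀ r, eLpNorm f p (volume.restrict (Metric.thickening δ (K r)))
      ≤ volume I * eLpNorm G p (volume.restrict V)
        + volume I ^ (p⁻¹).toReal * eLpNorm g p (surfaceMeasure Ω) := by
    intro r
    have hr := hch r
    have hseg := hr.segment_subset δ hδδ₀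
    have hΦm := hr.measurePreserving.measurable
    have hn : ∀ n, ∀ᵐ z ∂((volume.prod volume).restrict
        (Φ r ⁻¹' Metric.thickening (u n) (K r))),
        ‖f (Φ r z) - g (Φ r (z.1, 0))‖ₑ ≤ vertLIntegral (Φ r) I V G z.1 := by
      intro n
      have hsegn := hr.segment_subset (u n) ((hu n).le.trans hδδ₀)
      have hVn : Metric.thickening (u n) (frontier Ω) ⊆ V := Metric.thickening_mono (hu n).le _
      have hψn := hψ (u n) (hu n)
      filter_upwards [ae_enorm_sub_le_vertLIntegral hr.measurePreserving hr.lin hr.norm_v hIt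
        Metric.isOpen_thickening.measurableSet hr.map_le
        (hΦm Metric.isOpen_thickening.measurableSet)
        (fun y t hyt => ⟨(hsegn y t hyt).1, fun s hs =>
          ⟨((hseg y t (Metric.thickening_mono (hu n).le _ hyt)).2 s hs).1,
            ((hsegn y t hyt).2 s hs).2⟩⟩) hf hg hG hψn.contDiff hψn.tendsto
        hψn.tendsto_gradient hψn.tendsto_trace] with z hz
      exact hz.trans (lintegral_mono fun s =>
        Set.indicator_le_indicator_of_subset hVn (fun _ => zero_le) _)
    have hU : Φ r ⁻¹' Metric.thickening δ (K r)
        ⊆ ⋃ n, Φ r ⁻¹' Metric.thickening (u n) (K r) := by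
      intro z hz
      obtain ⟨w, hw, hd⟩ := Metric.mem_thickening_iff.1 hz
      obtain ⟨n, hn⟩ := (hut.eventually (lt_mem_nhds hd)).exists
      exact Set.mem_iUnion.2 ⟨n, Metric.mem_thickening_iff.2 ⟨w, hw, hn⟩⟩
    have hae : ∀ᵐ z ∂((volume.prod volume).restrict (Φ r ⁻¹' Metric.thickening δ (K r))),
        ‖f (Φ r z) - g (Φ r (z.1, 0))‖ₑ ≤ vertLIntegral (Φ r) I V G z.1 :=
      ae_restrict_of_ae_restrict_of_subset hU ((ae_restrict_iUnion_iff _ _).2 hn)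
    exact eLpNorm_le_of_ae_enorm_sub_le hr.measurePreserving hI0 hIt hV hr.map_le
      Metric.isOpen_thickening.measurableSet
      (fun z hz => ⟨(hseg z.1 z.2 hz).1, ((hseg z.1 z.2 hz).2 z.2 Set.right_mem_uIcc).1⟩)
      hf hg hG hae hp
  have hVU : V = ⋃ r, Metric.thickening δ (K r) := by
    simp only [V, hK, Metric.thickening_iUnion]
  -- Together with `1 ≤ 2 * c` this gives `(2 * c)^(1/p) ≤ 2 * c`, so one constant serves both terms
  -- and all `p`.
  have hq : (p⁻¹).toReal ≤ 1 := by
    have := ENNReal.toReal_mono ENNReal.one_ne_top (ENNReal.inv_le_one.2 hp)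
    simpa using this
  calc eLpNorm f p (volume.restrict V)
      ≤ ∑ r, eLpNorm f p (volume.restrict (Metric.thickening δ (K r))) := by
        conv_lhs => rw [hVU]
        exact eLpNorm_restrict_iUnion_le hf.aestronglyMeasurable
          (fun r => Metric.isOpen_thickening.measurableSet) hp
    _ ≤ ∑ _r : Fin M, (volume I * eLpNorm G p (volume.restrict V)
        + volume I ^ (p⁻¹).toReal * eLpNorm g p (surfaceMeasure Ω)) :=
        Finset.sum_le_sum fun r _ => hone r
    _ = M * (volume I * eLpNorm G p (volume.restrict V)
        + volume I ^ (p⁻¹).toReal * eLpNorm g p (surfaceMeasure Ω)) := by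
        rw [Finset.sum_const, Finset.card_univ, Fintype.card_fin, nsmul_eq_mul]
    _ ≤ M * (ENNReal.ofReal (2 * c) * (ENNReal.ofReal δ * eLpNorm G p (volume.restrict V)
        + ENNReal.ofReal δ ^ (p⁻¹).toReal * eLpNorm g p (surfaceMeasure Ω))) := by
        have h1 : ENNReal.ofReal (2 * c) ^ (p⁻¹).toReal ≤ ENNReal.ofReal (2 * c) :=
          (ENNReal.rpow_le_rpow_of_exponent_le h2c hq).trans_eq (ENNReal.rpow_one _)
        rw [hI, ENNReal.mul_rpow_of_nonneg _ _ (by positivity), mul_add (ENNReal.ofReal (2 * c)),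
          mul_assoc, mul_assoc]
        exact mul_le_mul_right (add_le_add_right (mul_le_mul_left h1 _) _) _
    _ = _ := by
        rw [← mul_assoc]
        push_cast
        rfl

/-- The trace inequality for differences of smooth functions. -/
lemma exists_eLpNorm_sub_le (hδ₀ : 0 < δ₀)
    (hch : ∀ r, IsGraphChart Ω δ₀ c κ (Φ r) (v r) (B r) (K r)) (hK : frontier Ω = ⋃ r, K r)
    {τ : ℝ} (hτ : 0 < τ) :
    ∃ C : ℝ≥0∞, C ≠ ⊤ ∧ ∀ ψ χ : Eucl N → ℝ, ContDiff ℝ ∞ ψ → ContDiff ℝ ∞ χ →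
      eLpNorm (fun x => ψ x - χ x) 1 (surfaceMeasure Ω)
        ≤ C * (eLpNorm (fun x => ψ x - χ x) 1
            (volume.restrict (Metric.thickening τ (frontier Ω)))
          + eLpNorm (fun x => gradient ψ x - gradient χ x) 1
            (volume.restrict (Metric.thickening τ (frontier Ω)))) := by
  obtain ⟨C, hC, h⟩ := exists_eLpNorm_trace_le hδ₀ hch hK hτ le_rfl
  refine ⟨C, hC, fun ψ χ hψ hχ => ?_⟩
  have hd : ContDiff ℝ ∞ fun x => ψ x - χ x := hψ.sub hχ
  have := h _ Metric.isOpen_thickening.measurableSet subset_rfl _ _ _ _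
    hd.continuous.stronglyMeasurable hd.continuous.stronglyMeasurable
    hd.continuous_gradient.stronglyMeasurable (isTraceApprox_const Ω _ hd)
  rwa [show gradient (fun x => ψ x - χ x) = fun x => gradient ψ x - gradient χ x from
    funext (gradient_sub_of_contDiff hψ hχ)] at this

lemma eLpNorm_one_sub_le_add {α F : Type*} [MeasurableSpace α] [NormedAddCommGroup F]
    {μ : Measure α} {a b h : α → F} (ha : AEStronglyMeasurable a μ)
    (hb : AEStronglyMeasurable b μ) (hh : AEStronglyMeasurable h μ) :
    eLpNorm (fun x => a x - b x) 1 μ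
      ≤ eLpNorm (fun x => a x - h x) 1 μ + eLpNorm (fun x => b x - h x) 1 μ := by
  have e : (fun x => a x - b x) = (fun x => a x - h x) - fun x => b x - h x := by
    funext x
    simp
  rw [e]
  exact eLpNorm_sub_le (ha.sub hh) (hb.sub hh) le_rfl

/-- Smooth functions converging in `W^{1,1}` near the boundary have convergent traces. -/
lemma exists_trace_limit (hΩb : Bornology.IsBounded Ω) (hδ₀ : 0 < δ₀)
    (hch : ∀ r, IsGraphChart Ω δ₀ c κ (Φ r) (v r) (B r) (K r)) (hK : frontier Ω = ⋃ r, K r)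
    {τ : ℝ} (hτ : 0 < τ) {f : Eucl N → ℝ} {G : Eucl N → Eucl N} {ψ : ℕ → Eucl N → ℝ}
    (hf : AEStronglyMeasurable f (volume.restrict (Metric.thickening τ (frontier Ω))))
    (hG : AEStronglyMeasurable G (volume.restrict (Metric.thickening τ (frontier Ω))))
    (hψ : ∀ k, ContDiff ℝ ∞ (ψ k))
    (hψf : Tendsto (fun k => eLpNorm (fun x => ψ k x - f x) 1
      (volume.restrict (Metric.thickening τ (frontier Ω)))) atTop (𝓝 0))
    (hψG : Tendsto (fun k => eLpNorm (fun x => gradient (ψ k) x - G x) 1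
      (volume.restrict (Metric.thickening τ (frontier Ω)))) atTop (𝓝 0)) :
    ∃ g : Eucl N → ℝ, MemLp g 1 (surfaceMeasure Ω) ∧
      Tendsto (fun k => eLpNorm (fun x => ψ k x - g x) 1 (surfaceMeasure Ω)) atTop (𝓝 0) := by
  obtain ⟨C, hC, h⟩ := exists_eLpNorm_sub_le hδ₀ hch hK hτ
  set V := Metric.thickening τ (frontier Ω)
  have hVb : Bornology.IsBounded V :=
    (hΩb.closure.subset frontier_subset_closure).thickening
  have hfin : ∀ {F : Type} [NormedAddCommGroup F] {u : Eucl N → F}, Continuous u →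
      eLpNorm u 1 (volume.restrict V) ≠ ⊤ := by
    intro F _ u hu
    have : IntegrableOn u V :=
      (hu.continuousOn.integrableOn_compact hVb.isCompact_closure).mono_set subset_closure
    exact (memLp_one_iff_integrable.2 this).eLpNorm_ne_top
  -- Comparison with the zero function in the trace inequality gives integrability on Γ without
  -- appeal to finiteness of the surface measure.
  have hmem : ∀ k, MemLp (ψ k) 1 (surfaceMeasure Ω) := by
    intro k
    refine ⟨(hψ k).continuous.aestronglyMeasurable, ?_⟩
    have h1 := h (ψ k) (fun _ => 0) (hψ k) contDiff_const
    have h0 : ∀ x : Eucl N, gradient (fun _ : Eucl N => (0 : ℝ)) x = 0 := fun x => by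
      simp [gradient]
    simp only [sub_zero, h0] at h1
    refine h1.trans_lt (ENNReal.mul_lt_top hC.lt_top (ENNReal.add_lt_top.2 ⟨?_, ?_⟩))
    · exact (hfin (hψ k).continuous).lt_top
    · exact (hfin (hψ k).continuous_gradient).lt_top
  have hcau : Tendsto (fun n : ℕ × ℕ => eLpNorm (ψ n.1 - ψ n.2) 1 (surfaceMeasure Ω)) atTop
      (𝓝 0) := by
    have hb : ∀ n : ℕ × ℕ, eLpNorm (ψ n.1 - ψ n.2) 1 (surfaceMeasure Ω)
        ≤ C * ((eLpNorm (fun x => ψ n.1 x - f x) 1 (volume.restrict V)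
            + eLpNorm (fun x => ψ n.2 x - f x) 1 (volume.restrict V))
          + (eLpNorm (fun x => gradient (ψ n.1) x - G x) 1 (volume.restrict V)
            + eLpNorm (fun x => gradient (ψ n.2) x - G x) 1 (volume.restrict V))) := fun n =>
      (h _ _ (hψ n.1) (hψ n.2)).trans (mul_le_mul_right (add_le_add
        (eLpNorm_one_sub_le_add (hψ n.1).continuous.aestronglyMeasurable
          (hψ n.2).continuous.aestronglyMeasurable hf)
        (eLpNorm_one_sub_le_add (hψ n.1).continuous_gradient.aestronglyMeasurable
          (hψ n.2).continuous_gradient.aestronglyMeasurable hG)) _)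
    have t1 : Tendsto (Prod.fst : ℕ × ℕ → ℕ) atTop atTop := by
      rw [← prod_atTop_atTop_eq]; exact tendsto_fst
    have t2 : Tendsto (Prod.snd : ℕ × ℕ → ℕ) atTop atTop := by
      rw [← prod_atTop_atTop_eq]; exact tendsto_snd
    have hlim := ENNReal.Tendsto.const_mul (a := C) (((hψf.comp t1).add (hψf.comp t2)).add
      ((hψG.comp t1).add (hψG.comp t2))) (Or.inr hC)
    simp only [add_zero, mul_zero] at hlim
    exact tendsto_of_tendsto_of_tendsto_of_le_of_le tendsto_const_nhds hlim
      (fun _ => zero_le) hb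
  have hcs : CauchySeq fun k => (hmem k).toLp (ψ k) :=
    (Lp.cauchySeq_Lp_iff_cauchySeq_eLpNorm _).2 (hcau.congr fun n => (eLpNorm_congr_ae
      ((hmem n.1).coeFn_toLp.sub (hmem n.2).coeFn_toLp)).symm)
  obtain ⟨g, hg⟩ := cauchySeq_tendsto_of_complete hcs
  refine ⟨g, Lp.memLp g, ?_⟩
  exact (Lp.tendsto_Lp_iff_tendsto_eLpNorm'' ψ hmem g (Lp.memLp g)).1 (by rwa [Lp.toLp_coeFn])

/-- The trace is unique up to null sets of the surface measure. -/
lemma IsTrace.ae_unique (hΩb : Bornology.IsBounded Ω) (hδ₀ : 0 < δ₀)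
    (hch : ∀ r, IsGraphChart Ω δ₀ c κ (Φ r) (v r) (B r) (K r)) (hK : frontier Ω = ⋃ r, K r)
    {f g g' : Eucl N → ℝ} (h : IsTrace Ω f g) (h' : IsTrace Ω f g') :
    g =ᵐ[surfaceMeasure Ω] g' := by
  obtain ⟨hg, V, G, ψ, hVo, hΓV, hS, hψ, hψf, hψG, hψg⟩ := h
  obtain ⟨hg', V', G', ψ', hVo', hΓV', hS', hψ', hψf', hψG', hψg'⟩ := h'
  have hcomp : IsCompact (frontier Ω) :=
    Metric.isCompact_of_isClosed_isBounded isClosed_frontier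
      (hΩb.closure.subset frontier_subset_closure)
  obtain ⟨τ, hτ, hτV⟩ := hcomp.exists_thickening_subset_open (hVo.inter hVo')
    (Set.subset_inter hΓV hΓV')
  set W := Metric.thickening τ (frontier Ω)
  have hWV : W ⊆ V := hτV.trans Set.inter_subset_left
  have hWV' : W ⊆ V' := hτV.trans Set.inter_subset_right
  obtain ⟨C, hC, hCb⟩ := exists_eLpNorm_sub_le hδ₀ hch hK hτ
  -- The two traces may come with different neighbourhoods and gradients; on a common thickening the
  -- gradients agree, so the two approximating sequences approach each other in `W^{1,1}`.
  have hGG : G =ᵐ[volume.restrict W] G' :=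
    (hS.1.mono hWV).ae_unique Metric.isOpen_thickening (hS'.1.mono hWV')
  have hle : ∀ {F : Type} [NormedAddCommGroup F] {T : Set (Eucl N)} (u : Eucl N → F), W ⊆ T →
      eLpNorm u 1 (volume.restrict W) ≤ eLpNorm u 1 (volume.restrict T) := fun u hT =>
    eLpNorm_mono_measure u (Measure.restrict_mono hT le_rfl)
  have hac : ∀ {T : Set (Eucl N)}, W ⊆ T → (volume.restrict W : Measure (Eucl N)) ≤
      volume.restrict T := fun hT => Measure.restrict_mono hT le_rfl
  have hb : ∀ k, eLpNorm (fun x => g x - g' x) 1 (surfaceMeasure Ω)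
      ≤ eLpNorm (fun x => ψ k x - g x) 1 (surfaceMeasure Ω)
        + (C * ((eLpNorm (fun x => ψ k x - f x) 1 (volume.restrict V)
            + eLpNorm (fun x => ψ' k x - f x) 1 (volume.restrict V'))
          + (eLpNorm (fun x => gradient (ψ k) x - G x) 1 (volume.restrict V)
            + eLpNorm (fun x => gradient (ψ' k) x - G' x) 1 (volume.restrict V')))
          + eLpNorm (fun x => ψ' k x - g' x) 1 (surfaceMeasure Ω)) := by
    intro k
    have m1 := (hψ k).continuous.aestronglyMeasurable (μ := surfaceMeasure Ω)
    have m2 := (hψ' k).continuous.aestronglyMeasurable (μ := surfaceMeasure Ω)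
    have e1 : eLpNorm (fun x => g x - g' x) 1 (surfaceMeasure Ω)
        ≤ eLpNorm (fun x => ψ k x - g x) 1 (surfaceMeasure Ω)
          + (eLpNorm (fun x => ψ k x - ψ' k x) 1 (surfaceMeasure Ω)
            + eLpNorm (fun x => ψ' k x - g' x) 1 (surfaceMeasure Ω)) := by
      have s1 := eLpNorm_one_sub_le_add hg.1 hg'.1 m1
      have s2 := eLpNorm_one_sub_le_add hg'.1 m1 m2
      rw [show (fun x => g x - ψ k x) = g - ψ k from rfl, eLpNorm_sub_comm] at s1
      rw [show (fun x => g' x - ψ' k x) = g' - ψ' k from rfl, eLpNorm_sub_comm, add_comm] at s2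
      exact s1.trans (add_le_add_right s2 _)
    refine e1.trans (add_le_add_right (add_le_add_left ((hCb _ _ (hψ k) (hψ' k)).trans
      (mul_le_mul_right (add_le_add ?_ ?_) _)) _) _)
    · exact (eLpNorm_one_sub_le_add (hψ k).continuous.aestronglyMeasurable
        (hψ' k).continuous.aestronglyMeasurable (hS.2.1.1.mono_measure (hac hWV))).trans
        (add_le_add (hle _ hWV) (hle _ hWV'))
    · refine (eLpNorm_one_sub_le_add (hψ k).continuous_gradient.aestronglyMeasurable
        (hψ' k).continuous_gradient.aestronglyMeasurable
        (hS.2.2.1.mono_measure (hac hWV))).trans (add_le_add (hle _ hWV) ?_)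
      refine le_trans (le_of_eq (eLpNorm_congr_ae ?_)) (hle _ hWV')
      filter_upwards [hGG] with x hx using by rw [hx]
  have hlim := hψg.add ((ENNReal.Tendsto.const_mul (a := C)
    ((hψf.add hψf').add (hψG.add hψG')) (Or.inr hC)).add hψg')
  simp only [add_zero, mul_zero] at hlim
  have h0 : eLpNorm (fun x => g x - g' x) 1 (surfaceMeasure Ω) = 0 :=
    le_antisymm (ge_of_tendsto' hlim hb) zero_le
  filter_upwards [(eLpNorm_eq_zero_iff (hg.1.sub hg'.1) one_ne_zero).1 h0] with x hx
  exact sub_eq_zero.1 hx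

end Charts

/-! ### Tubular neighbourhoods and the main theorem -/

/-- Nonemptiness is essential: the distance to the empty set is 0 by convention, while its
thickening is empty. -/
lemma tubularNbhd_eq_thickening {N : ℕ} {Ω : Set (Eucl N)} (h : (frontier Ω).Nonempty) (δ : ℝ) :
    tubularNbhd Ω δ = Metric.thickening δ (frontier Ω) := by
  ext x
  have : |bdrySignedDist Ω x| = Metric.infDist x (frontier Ω) := by
    unfold bdrySignedDist
    split_ifs
    · rw [abs_neg, abs_of_nonneg Metric.infDist_nonneg]
    · rw [abs_of_nonneg Metric.infDist_nonneg]
  rw [tubularNbhd, Set.mem_ofPred_eq, this, Metric.infDist_lt_iff h, Metric.mem_thickening_iff]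

/-- A set with empty frontier is clopen, hence empty or the whole space, and the latter is unbounded
in positive dimension. -/
lemma frontier_nonempty_of_isBounded {N : ℕ} (hN : N ≠ 0) {Ω : Set (Eucl N)}
    (hΩ : Ω.Nonempty) (hΩb : Bornology.IsBounded Ω) : (frontier Ω).Nonempty := by
  have : Nonempty (Fin N) := ⟨⟨0, Nat.pos_of_ne_zero hN⟩⟩
  rw [Set.nonempty_iff_ne_empty, Ne, ← isClopen_iff_frontier_eq_empty, isClopen_iff]
  rintro (h | h)
  · exact hΩ.ne_empty h
  · rw [h] at hΩb
    exact NormedSpace.unbounded_univ ℝ (Eucl N) hΩb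

theorem mainTheorem9 (N : ℕ) (hN : 2 ≤ N) (Ω : Set (Eucl N)) (hΩo : IsOpen Ω)
    (hΩc : IsConnected Ω) (hΩb : Bornology.IsBounded Ω) (hΩ : HasC11Boundary Ω) :
    ∃ δ₀ : ℝ, 0 < δ₀ ∧ ∀ p : ℝ≥0∞, 1 ≤ p → ∃ C : ℝ≥0,
      ∀ δ₁ : ℝ, 0 < δ₁ → δ₁ ≤ δ₀ →
      ∀ (f : Eucl N → ℝ) (G : Eucl N → Eucl N),
        MemSobolevWithGradient p (tubularNbhd Ω δ₁) f G →
        ∃ g : Eucl N → ℝ,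
          IsTrace Ω f g ∧ (∀ g' : Eucl N → ℝ, IsTrace Ω f g' → g' =ᵐ[surfaceMeasure Ω] g) ∧
          MemLp g p (surfaceMeasure Ω) ∧
          eLpNorm f p (volume.restrict (tubularNbhd Ω δ₁)) ≤
            (C : ℝ≥0∞) * (ENNReal.ofReal δ₁ * eLpNorm G p (volume.restrict (tubularNbhd Ω δ₁)) +
              ENNReal.ofReal δ₁ ^ (p⁻¹).toReal * eLpNorm g p (surfaceMeasure Ω)) := by
  obtain ⟨M, δ₀, c, κ, Φ, v, B, K, hδ₀, hc, hch, hK⟩ := hΩ.exists_isGraphChart hΩb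
  refine ⟨δ₀, hδ₀, fun p hp => ⟨M * (2 * c).toNNReal, fun δ₁ hδ₁ hδ₁₀ f G hS => ?_⟩⟩
  have hne : (frontier Ω).Nonempty :=
    frontier_nonempty_of_isBounded (by omega) hΩc.nonempty hΩb
  rw [tubularNbhd_eq_thickening hne] at hS ⊢
  obtain ⟨hw, hfp, hGp⟩ := hS
  set U := Metric.thickening δ₁ (frontier Ω)
  have hU : IsOpen U := Metric.isOpen_thickening
  have hUb : Bornology.IsBounded U := (hΩb.closure.subset frontier_subset_closure).thickening
  -- Finite measure of the tube puts `f` and `G` in `L¹`, where the whole approximation takes place.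
  have : IsFiniteMeasure (volume.restrict U : Measure (Eucl N)) :=
    ⟨by rw [Measure.restrict_apply_univ]; exact hUb.measure_lt_top⟩
  have hf1 : MemLp f 1 (volume.restrict U) := hfp.mono_exponent hp
  have hG1 : MemLp G 1 (volume.restrict U) := hGp.mono_exponent hp
  obtain ⟨ψ, hψ, hψf, hψG⟩ := hw.exists_smooth_approx hU (memLp_one_iff_integrable.1 hf1)
    (memLp_one_iff_integrable.1 hG1)
  have hmono : ∀ δ' < δ₁, Metric.thickening δ' (frontier Ω) ⊆ U := fun δ' h =>
    Metric.thickening_mono h.le _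
  have hle : ∀ δ' < δ₁, (volume.restrict (Metric.thickening δ' (frontier Ω)) : Measure (Eucl N))
      ≤ volume.restrict U := fun δ' h => Measure.restrict_mono (hmono δ' h) le_rfl
  have hf' : ∀ δ' < δ₁, Tendsto (fun k => eLpNorm (fun x => ψ k x - f x) 1
      (volume.restrict (Metric.thickening δ' (frontier Ω)))) atTop (𝓝 0) := fun δ' h =>
    tendsto_of_tendsto_of_tendsto_of_le_of_le tendsto_const_nhds hψf (fun _ => zero_le)
      fun k => eLpNorm_mono_measure _ (hle δ' h)
  have hG' : ∀ δ' < δ₁, Tendsto (fun k => eLpNorm (fun x => gradient (ψ k) x - G x) 1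
      (volume.restrict (Metric.thickening δ' (frontier Ω)))) atTop (𝓝 0) := by
    intro δ' h
    refine hψG _ (δ₁ - δ') (sub_pos.2 h) Metric.isOpen_thickening.measurableSet ?_
    exact (Metric.thickening_thickening_subset _ _ _).trans (by rw [sub_add_cancel])
  -- Any positive number below `δ₁` would do: the trace depends only on `f` near Γ.
  set τ := δ₁ / 2
  have hτ : 0 < τ := half_pos hδ₁
  have hτ₁ : τ < δ₁ := half_lt_self hδ₁
  obtain ⟨g₀, hg₀, hψg₀⟩ := exists_trace_limit hΩb hδ₀ hch hK hτ (hf1.1.mono_measure (hle τ hτ₁))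
    (hG1.1.mono_measure (hle τ hτ₁)) hψ (hf' τ hτ₁) (hG' τ hτ₁)
  -- Strongly measurable representatives are needed for the integrals over lines; changes on null
  -- sets affect neither the norms nor the convergences.
  set g := hg₀.1.mk g₀
  have hgm : StronglyMeasurable g := hg₀.1.stronglyMeasurable_mk
  set f₁ := hf1.1.mk f
  set G₁ := hG1.1.mk G
  have hf₁m : StronglyMeasurable f₁ := hf1.1.stronglyMeasurable_mk
  have hG₁m : StronglyMeasurable G₁ := hG1.1.stronglyMeasurable_mk
  have happ : ∀ δ' < δ₁, IsTraceApprox Ω (Metric.thickening δ' (frontier Ω)) f G g ψ := fun δ' h =>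
    IsTraceApprox.congr ⟨hψ, hf' δ' h, hG' δ' h, hψg₀⟩ (ae_eq_refl _) (ae_eq_refl _) hg₀.1.ae_eq_mk
  have happ₁ : ∀ δ' < δ₁, IsTraceApprox Ω (Metric.thickening δ' (frontier Ω)) f₁ G₁ g ψ :=
    fun δ' h => (happ δ' h).congr
      (ae_restrict_of_ae_restrict_of_subset (hmono δ' h) hf1.1.ae_eq_mk)
      (ae_restrict_of_ae_restrict_of_subset (hmono δ' h) hG1.1.ae_eq_mk) (ae_eq_refl _)
  have htr : IsTrace Ω f g := ⟨hg₀.ae_eq hg₀.1.ae_eq_mk, Metric.thickening τ (frontier Ω), G, ψ,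
    Metric.isOpen_thickening, Metric.self_subset_thickening hτ _,
    ⟨hw.mono (hmono τ hτ₁), hf1.mono_measure (hle τ hτ₁), hG1.mono_measure (hle τ hτ₁)⟩, hψ,
    (happ τ hτ₁).tendsto, (happ τ hτ₁).tendsto_gradient, (happ τ hτ₁).tendsto_trace⟩
  have ef : eLpNorm f₁ p (volume.restrict U) = eLpNorm f p (volume.restrict U) :=
    eLpNorm_congr_ae hf1.1.ae_eq_mk.symm
  have eG : eLpNorm G₁ p (volume.restrict U) = eLpNorm G p (volume.restrict U) :=
    eLpNorm_congr_ae hG1.1.ae_eq_mk.symm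
  refine ⟨g, htr, fun g' h' => IsTrace.ae_unique hΩb hδ₀ hch hK h' htr, ?_, ?_⟩
  -- This constant depends on `τ`, hence on `δ₁`; only its finiteness is used, for membership in
  -- `Lᵖ(Γ)`.
  · obtain ⟨C, hC, hCb⟩ := exists_eLpNorm_trace_le hδ₀ hch hK hτ hp
    refine ⟨hgm.aestronglyMeasurable, (hCb _ Metric.isOpen_thickening.measurableSet subset_rfl
      _ _ _ _ hf₁m hgm hG₁m (happ₁ τ hτ₁)).trans_lt (ENNReal.mul_lt_top hC.lt_top
      (ENNReal.add_lt_top.2 ⟨?_, ?_⟩))⟩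
    · exact (eLpNorm_mono_measure _ (hle τ hτ₁)).trans_lt (ef ▸ hfp.2)
    · exact (eLpNorm_mono_measure _ (hle τ hτ₁)).trans_lt (eG ▸ hGp.2)
  · rw [← ef, ← eG]
    exact eLpNorm_thickening_le hc hch hK hδ₁ hδ₁₀ hp hf₁m hgm hG₁m happ₁
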